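/- Let $\mathbb{T}$ be the unit circle with normalised arc length measure, let $H^2\subset L^2(\mathbb{T})$ and $H^\infty\subset L^\infty(\mathbb{T})$ be the Hardy spaces of the open unit disk $\mathbb{D}$, and for $\psi\in L^\infty(\mathbb{T})$ let $T_\psi:H^2\to H^2$, $T_\psi f=P_+(\psi f)$, be the Toeplitz operator with symbol $\psi$, where $P_+$ is the orthogonal projection of $L^2(\mathbb{T})$ onto $H^2$. For $b\in H^\infty$ with $\|b\|_{H^\infty}\le 1$, let $\mathcal{H}(b)$ be the de Branges--Rovnyak space, i.e. the image of $H^2$ under $(I-T_bT_{\overline b})^{1/2}$, with the norm that makes $(I-T_bT_{\overline b})^{1/2}$ a partial isometry of $H^2$ onto $\mathcal{H}(b)$. Call $b$ non-extreme if it is not an extreme point of the closed unit ball of $H^\infty$. For $f\in H^2$ and $0<r<1$ write $f_r(z)=f(rz)$ ($z\in\mathbb{D}$). Theorem. Let $\gamma:(0,1)\to(1,\infty)$ be a function such that $\log\gamma(r)=o\bigl((1-r)^{-1}\bigr)$ as $r\to1^-$. Then there exist a non-extreme $b\in H^\infty$ with $\|b\|_{H^\infty}\le 1$, a function $f\in\mathcal{H}(b)$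 and $r_0\in(0,1)$ such that, for all $r\in(r_0,1)$, $f_r\in\mathcal{H}(b)$ and $\|f_r\|_{\mathcal{H}(b)}\ge\gamma(r)$. -/

import Mathlib

open Set Filter Topology MeasureTheory Asymptotics
open scoped ENNReal ComplexConjugate

noncomputable section

namespace DBR

/-- The space `L^p(𝕋)` of the unit circle with normalised arc length measure. The point `t` of
`UnitAddCircle = ℝ/ℤ` stands for `exp (2 π i t)`, so that `fourier n` is the monomial `z ^ n`. -/
abbrev LpT (p : ℝ≥0∞) : Type :=
  Lp ℂ p (AddCircle.haarAddCircle : Measure UnitAddCircle)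

lemma integrable_coe {p : ℝ≥0∞} [hp : Fact (1 ≤ p)] (f : LpT p) :
    Integrable (f : UnitAddCircle → ℂ) AddCircle.haarAddCircle :=
  (Lp.memLp f).integrable hp.out

/-- The `n`-th Fourier coefficient as a linear functional on `L^p(𝕋)`, `p ≥ 1`. -/
def coeff (p : ℝ≥0∞) [Fact (1 ≤ p)] (n : ℤ) : LpT p →ₗ[ℂ] ℂ where
  toFun f := fourierCoeff (f : UnitAddCircle → ℂ) n
  map_add' f g := by
    rw [fourierCoeff_congr_ae (Lp.coeFn_add f g),
      fourierCoeff.add (integrable_coe f) (integrable_coe g)]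
    rfl
  map_smul' c f := by
    rw [fourierCoeff_congr_ae (Lp.coeFn_smul c f), fourierCoeff.const_smul]
    rfl

/-- The Hardy space `H^p`, `p ≥ 1`, as the space of boundary functions: those elements of
`L^p(𝕋)` whose Fourier coefficients of negative index vanish. -/
def hardy (p : ℝ≥0∞) [Fact (1 ≤ p)] : Submodule ℂ (LpT p) where
  carrier := {f | ∀ n : ℤ, n < 0 → coeff p n f = 0}
  add_mem' hf hg n hn := by rw [map_add, hf n hn, hg n hn, add_zero]
  zero_mem' n _ := map_zero _
  smul_mem' c f hf n hn := by rw [map_smul, hf n hn, smul_zero]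

/-- The Hardy space `H^2`. -/
abbrev H2 : Type := hardy 2

/-- The space `H^∞`. -/
abbrev HInf : Type := hardy ∞

lemma coeff_two_eq_inner (n : ℤ) (f : LpT 2) :
    coeff 2 n f = inner ℂ (fourierLp 2 n : LpT 2) f := by
  have h := fourierBasis.repr_apply_apply f n
  rw [fourierBasis_repr, coe_fourierBasis] at h
  exact h

lemma isClosed_hardy_two : IsClosed (hardy 2 : Set (LpT 2)) := by
  have h : (hardy 2 : Set (LpT 2)) =
      ⋂ (n : ℤ) (_ : n < 0), {f | inner ℂ (fourierLp 2 n : LpT 2) f = 0} := by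
    ext f
    simp only [mem_iInter, mem_ofPred_eq, ← coeff_two_eq_inner]
    rfl
  rw [h]
  exact isClosed_biInter fun n _ =>
    isClosed_eq (continuous_const.inner continuous_id) continuous_const

instance : CompleteSpace H2 := isClosed_hardy_two.completeSpace_coe

/-- The multiplication operator `f ↦ ψ f` on `L^2(𝕋)`, for `ψ ∈ L^∞(𝕋)`. -/
def mulOp (ψ : LpT ∞) : LpT 2 →L[ℂ] LpT 2 :=
  (ContinuousLinearMap.mul ℂ ℂ).holderL AddCircle.haarAddCircle ∞ 2 2 ψ

/-- The Toeplitz operator `T_ψ f = P₊ (ψ f)` on `H^2`, where `P₊` is the orthogonal projection of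
`L^2(𝕋)` onto `H^2`. -/
def toeplitz (ψ : LpT ∞) : H2 →L[ℂ] H2 :=
  (hardy 2).orthogonalProjectionOnto ∘L mulOp ψ ∘L (hardy 2).subtypeL

/-- The operator `I - T_b T_{b̄}` on `H^2`. -/
def defect (b : HInf) : H2 →L[ℂ] H2 :=
  1 - toeplitz (b : LpT ∞) ∘L toeplitz (star (b : LpT ∞))

/-- The positive square root of a positive operator on a complex Hilbert space. -/
def opSqrt {H : Type*} [NormedAddCommGroup H] [InnerProductSpace ℂ H] [CompleteSpace H]
    (T : H →L[ℂ] H) : H →L[ℂ] H :=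
  CFC.sqrt T

lemma opSqrt_mul_self {H : Type*} [NormedAddCommGroup H] [InnerProductSpace ℂ H]
    [CompleteSpace H] {T : H →L[ℂ] H} (hT : T.IsPositive) : opSqrt T * opSqrt T = T :=
  CFC.sqrt_mul_sqrt_self T (ContinuousLinearMap.nonneg_iff_isPositive T |>.mpr hT)

lemma opSqrt_isPositive {H : Type*} [NormedAddCommGroup H] [InnerProductSpace ℂ H]
    [CompleteSpace H] (T : H →L[ℂ] H) : (opSqrt T).IsPositive :=
  ContinuousLinearMap.nonneg_iff_isPositive _ |>.mp (CFC.sqrt_nonneg T)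

/-- The operator `(I - T_b T_{b̄})^{1/2}` on `H^2` (the positive square root). -/
def defectSqrt (b : HInf) : H2 →L[ℂ] H2 := opSqrt (defect b)

/-- The de Branges–Rovnyak space `H(b)`, as a set of elements of `H^2`: the image of `H^2` under
`(I - T_b T_{b̄})^{1/2}`. -/
def space (b : HInf) : Submodule ℂ H2 := (defectSqrt b).range

/-- The norm of `H(b)`: it makes `(I - T_b T_{b̄})^{1/2}` a partial isometry of `H^2` onto `H(b)`,
see `hbNorm_defectSqrt`. (Only meaningful for `f` in `H(b)`.) -/
def hbNorm (b : HInf) (f : H2) : ℝ := sInf {x | ∃ g : H2, defectSqrt b g = f ∧ ‖g‖ = x}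

/-- `b` is a non-extreme point of the closed unit ball of `H^∞`. -/
def NonExtreme (b : HInf) : Prop :=
  b ∈ Metric.closedBall (0 : HInf) 1 ∧ b ∉ (Metric.closedBall (0 : HInf) 1).extremePoints ℝ

/-- The value at a point `z` of the open unit disk of the holomorphic extension of `f ∈ H^2`. -/
def eval (f : H2) (z : ℂ) : ℂ := ∑' n : ℕ, coeff 2 n (f : LpT 2) * z ^ n

lemma coeff_fourierLp (m n : ℤ) :
    coeff 2 m (fourierLp 2 n : LpT 2) = if m = n then 1 else 0 := by
  rw [coeff_two_eq_inner]
  exact orthonormal_iff_ite.mp orthonormal_fourier m n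

/-- The monomial `z ^ n` as an element of `H^2`. -/
def monomial (n : ℕ) : H2 :=
  ⟨fourierLp 2 (n : ℤ), fun m hm => by rw [coeff_fourierLp, if_neg (by omega)]⟩

/-- The dilate `f_r` of `f ∈ H^2`, for `|r| < 1`: the element of `H^2` with `f_r(z) = f(rz)`,
see `eval_dilate`. -/
def dilate (f : H2) (r : ℝ) : H2 := ∑' n : ℕ, (coeff 2 n (f : LpT 2) * (r : ℂ) ^ n) • monomial n

/-! ### The definitions have the intended properties -/

lemma norm_monomial (n : ℕ) : ‖monomial n‖ = 1 :=
  orthonormal_fourier.1 (n : ℤ)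

lemma norm_coeff_le (f : H2) (n : ℤ) : ‖coeff 2 n (f : LpT 2)‖ ≤ ‖f‖ := by
  rw [coeff_two_eq_inner]
  refine (norm_inner_le_norm _ _).trans ?_
  rw [orthonormal_fourier.1 n, one_mul]
  rfl

lemma summable_coeff (f : H2) {z : ℂ} (hz : ‖z‖ < 1) :
    Summable fun n : ℕ => ‖coeff 2 n (f : LpT 2) * z ^ n‖ := by
  refine Summable.of_nonneg_of_le (fun _ => norm_nonneg _) (fun n => ?_)
    ((summable_geometric_of_lt_one (norm_nonneg z) hz).mul_left ‖f‖)
  rw [norm_mul, norm_pow]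
  exact mul_le_mul_of_nonneg_right (norm_coeff_le f n) (by positivity)

lemma coeff_dilate (f : H2) {r : ℝ} (hr : |r| < 1) (m : ℕ) :
    coeff 2 m (dilate f r : LpT 2) = coeff 2 m (f : LpT 2) * (r : ℂ) ^ m := by
  have hs : Summable fun n : ℕ => (coeff 2 n (f : LpT 2) * (r : ℂ) ^ n) • monomial n := by
    refine Summable.of_norm ?_
    simpa only [norm_smul, norm_monomial, mul_one] using
      summable_coeff f (z := (r : ℂ)) (by simpa using hr)
  have h := hs.hasSum.mapL
    ((innerSL ℂ (fourierLp 2 (m : ℤ) : LpT 2)) ∘L (hardy 2).subtypeL)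
  have e : (fun n : ℕ => ((innerSL ℂ (fourierLp 2 (m : ℤ) : LpT 2)) ∘L (hardy 2).subtypeL)
      ((coeff 2 n (f : LpT 2) * (r : ℂ) ^ n) • monomial n)) =
      fun n : ℕ => if n = m then coeff 2 m (f : LpT 2) * (r : ℂ) ^ m else 0 := by
    funext n
    rw [map_smul]
    change _ • inner ℂ (fourierLp 2 (m : ℤ) : LpT 2) (fourierLp 2 (n : ℤ) : LpT 2) = _
    rw [← coeff_two_eq_inner, coeff_fourierLp]
    by_cases hnm : n = m
    · subst hnm; simp
    · simp [hnm, Ne.symm hnm]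
  rw [e] at h
  rw [coeff_two_eq_inner]
  exact h.unique (hasSum_ite_eq m _)

/-- `f_r(z) = f(rz)`. -/
theorem eval_dilate (f : H2) {r : ℝ} (hr : |r| < 1) (z : ℂ) :
    eval (dilate f r) z = eval f (r * z) := by
  refine tsum_congr fun n => ?_
  rw [coeff_dilate f hr, mul_pow, mul_assoc]

lemma mulOp_coe (ψ : LpT ∞) (f : LpT 2) :
    mulOp ψ f =ᵐ[AddCircle.haarAddCircle] fun t => ψ t * f t :=
  ContinuousLinearMap.coeFn_holder _ ψ f

lemma norm_mulOp_le (ψ : LpT ∞) (f : LpT 2) : ‖mulOp ψ f‖ ≤ ‖ψ‖ * ‖f‖ := by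
  refine (ContinuousLinearMap.norm_holder_apply_apply_le (ContinuousLinearMap.mul ℂ ℂ) ψ f).trans ?_
  rw [ContinuousLinearMap.opNorm_mul, one_mul]

lemma inner_mulOp (ψ : LpT ∞) (f g : LpT 2) :
    inner ℂ (mulOp ψ f) g = inner ℂ f (mulOp (star ψ) g) := by
  rw [L2.inner_def, L2.inner_def]
  refine integral_congr_ae ?_
  filter_upwards [mulOp_coe ψ f, mulOp_coe (star ψ) g, Lp.coeFn_star ψ] with t h1 h2 h3
  rw [h1, h2, h3]
  simp only [RCLike.inner_apply', Pi.star_apply, RCLike.star_def, map_mul]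
  ring

lemma norm_toeplitz_apply_le (ψ : LpT ∞) (f : H2) : ‖toeplitz ψ f‖ ≤ ‖ψ‖ * ‖f‖ :=
  ((hardy 2).norm_orthogonalProjectionOnto_apply_le _).trans (norm_mulOp_le ψ f)

/-- The adjoint of `T_ψ` is `T_{ψ̄}`. -/
lemma inner_toeplitz (ψ : LpT ∞) (f g : H2) :
    inner ℂ (toeplitz ψ f) g = inner ℂ f (toeplitz (star ψ) g) := by
  change inner ℂ ((hardy 2).orthogonalProjectionOnto (mulOp ψ f)) g =
    inner ℂ f ((hardy 2).orthogonalProjectionOnto (mulOp (star ψ) g))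
  rw [Submodule.inner_orthogonalProjectionOnto_eq_of_mem_right,
    Submodule.inner_orthogonalProjectionOnto_eq_of_mem_left]
  exact inner_mulOp ψ f g

/-- `I - T_b T_{b̄}` is a positive operator, so that `defectSqrt` is its positive square root. -/
theorem defect_isPositive (b : HInf) (hb : ‖b‖ ≤ 1) : (defect b).IsPositive := by
  rw [ContinuousLinearMap.isPositive_iff_complex]
  intro f
  have key : inner ℂ (defect b f) f =
      ((‖f‖ ^ 2 - ‖toeplitz (star (b : LpT ∞)) f‖ ^ 2 : ℝ) : ℂ) := by
    change inner ℂ (f - toeplitz (b : LpT ∞) (toeplitz (star (b : LpT ∞)) f)) f = _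
    rw [inner_sub_left, inner_toeplitz]
    erw [inner_self_eq_norm_sq_to_K (𝕜 := ℂ) f,
      inner_self_eq_norm_sq_to_K (𝕜 := ℂ) (toeplitz (star (b : LpT ∞)) f)]
    push_cast
    rfl
  have hn : ‖toeplitz (star (b : LpT ∞)) f‖ ≤ ‖f‖ := by
    refine (norm_toeplitz_apply_le _ f).trans ?_
    have : ‖star (b : LpT ∞)‖ ≤ 1 := by
      have e : ‖star (b : LpT ∞)‖ = ‖(b : LpT ∞)‖ := by
        rw [Lp.norm_def, Lp.norm_def]
        congr 1
        refine eLpNorm_congr_norm_ae ?_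
        filter_upwards [Lp.coeFn_star (b : LpT ∞)] with t ht
        rw [ht, Pi.star_apply, norm_star]
      rw [e]; exact hb
    nlinarith [norm_nonneg f]
  rw [key]
  refine ⟨rfl, ?_⟩
  have := norm_nonneg (toeplitz (star (b : LpT ∞)) f)
  change 0 ≤ ‖f‖ ^ 2 - ‖toeplitz (star (b : LpT ∞)) f‖ ^ 2
  nlinarith

theorem defectSqrt_mul_self (b : HInf) (hb : ‖b‖ ≤ 1) :
    defectSqrt b * defectSqrt b = defect b :=
  opSqrt_mul_self (defect_isPositive b hb)

/-- The defining property of the norm of `H(b)`. -/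
theorem hbNorm_defectSqrt (b : HInf) (g : H2) (hg : g ∈ (defectSqrt b).kerᗮ) :
    hbNorm b (defectSqrt b g) = ‖g‖ := by
  refine IsLeast.csInf_eq ⟨⟨g, rfl, rfl⟩, ?_⟩
  rintro x ⟨g', hg', rfl⟩
  have hk : g' - g ∈ (defectSqrt b).ker := by
    rw [LinearMap.mem_ker, map_sub]
    exact sub_eq_zero.mpr hg'
  have h0 : inner ℂ g (g' - g) = 0 := Submodule.inner_left_of_mem_orthogonal hk hg
  have := norm_add_sq_eq_norm_sq_add_norm_sq_of_inner_eq_zero g (g' - g) h0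
  rw [add_sub_cancel] at this
  nlinarith [norm_nonneg g, norm_nonneg g', norm_nonneg (g' - g)]

end DBR

end

/-
The symbol is `b = B² exp (-q)`. Here `B` is the Blaschke product with zeros `wⱼ = 1 - 8⁻ʲ`, and
`q` is holomorphic with `Re q = |A|²` on the circle for `A = (1 - z)⁴ exp (-h) / 32`,
`h = ∑ₙ 2⁻ⁿ / (1 + δₙ - z)`. The function `A` lies in the disc algebra, has no zeros in the disc,
and is very small near `1`, at a rate governed by the choice of `δₙ → 0`. On the circle
`|A|² ≤ 1 - |b|² ≤ 2 |A|²`, so `b` is non-extreme but nearly unimodular near `1`.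

Let `f = ∑ⱼ 8⁻²ʲ k_{wⱼ}` with Szegő kernels `k_w`. As `b` vanishes at the `wⱼ`, `f` is in the
kernel of the adjoint of `T_b`, hence in `H(b)`. Every dilate `f_r` lies in `H(b)`: the bound
`|A|² + |b|² ≤ 1` gives `‖T_A x‖ ≤ ‖(I - T_b T_b*)^{1/2} x‖`, and dilation, which is self-adjoint,
factors through `T_A` because `A` has no zeros.

For the lower bound, `f_r` is tested against `T_b y` with `y = exp (2⁻ⁿ / (1 + δₙ - z))`. The bound
`2 |A y|² ≤ 1` gives `‖(I - T_b T_b*)^{1/2} T_b y‖ ≤ 1`, while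
`⟨f_r, T_b y⟩ = ∑ⱼ 8⁻²ʲ (b y)(r wⱼ)` has nonnegative terms only. For some `j` the point `r wⱼ` is at
distance comparable to `1 - r` both from `1` and from the zeros of `B`, so its term is at least
`κ (1 - r)² exp (2⁻ⁿ / (3 (1 - r)))`; letting `n → ∞` slowly as `r → 1` makes this exceed `γ r`.
-/

noncomputable section

namespace DBR

local notation "σ" => (AddCircle.haarAddCircle : Measure UnitAddCircle)

section Hilbert

variable {𝕜 E F : Type*} [RCLike 𝕜] [NormedAddCommGroup E] [InnerProductSpace 𝕜 E]
  [CompleteSpace E] [NormedAddCommGroup F] [InnerProductSpace 𝕜 F] [CompleteSpace F]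

/-- Douglas' range criterion, for a single vector. -/
lemma mem_range_adjoint_of_norm_inner_le {T : E →L[𝕜] F} {f : E} {C : ℝ}
    (hf : ∀ x, ‖inner 𝕜 f x‖ ≤ C * ‖T x‖) : f ∈ (ContinuousLinearMap.adjoint T).range := by
  have h_ker : (innerSL 𝕜 f : E →ₗ[𝕜] 𝕜) ∈ (LinearMap.ker (T : E →ₗ[𝕜] F)).dualAnnihilator := by
    refine (Submodule.mem_dualAnnihilator _).mpr fun x hx => norm_le_zero_iff.mp ?_
    have hTx : T x = 0 := hx
    simpa only [hTx, norm_zero, mul_zero, ContinuousLinearMap.coe_coe, innerSL_apply_apply]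
      using hf x
  rw [← LinearMap.range_dualMap_eq_dualAnnihilator_ker] at h_ker
  obtain ⟨φ, hφ⟩ := h_ker
  have hφT (x : E) : φ (T x) = inner 𝕜 f x := LinearMap.congr_fun hφ x
  let φ_range : StrongDual 𝕜 (T : E →ₗ[𝕜] F).range :=
    (φ.domRestrict _).mkContinuous C (by
      rintro ⟨_, x, rfl⟩
      exact (congrArg norm (hφT x)).trans_le (hf x))
  obtain ⟨L, hL, -⟩ := exists_extension_norm_eq _ φ_range
  refine ⟨(InnerProductSpace.toDual 𝕜 F).symm L, ext_inner_right 𝕜 fun x => ?_⟩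
  rw [ContinuousLinearMap.coe_coe, ContinuousLinearMap.adjoint_inner_left,
    InnerProductSpace.toDual_symm_apply]
  exact (hL ⟨T x, x, rfl⟩).trans (hφT x)

end Hilbert

section Circle

/-- The point `exp (2 π i t)` of the unit circle, as a complex number. -/
def circlePoint (t : UnitAddCircle) : ℂ := AddCircle.toCircle t

lemma norm_circlePoint (t : UnitAddCircle) : ‖circlePoint t‖ = 1 := Circle.norm_coe _

lemma continuous_circlePoint : Continuous circlePoint :=
  continuous_subtype_val.comp AddCircle.continuous_toCircle

lemma fourier_eq_circlePoint_zpow (n : ℤ) (t : UnitAddCircle) :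
    fourier n t = circlePoint t ^ n := by
  rw [fourier_apply, AddCircle.toCircle_zsmul, Circle.coe_zpow, circlePoint]

lemma integral_comp_circlePoint (G : ℂ → ℂ) :
    ∫ t, G (circlePoint t) ∂σ = Real.circleAverage G 0 1 := by
  have h_interval : ∫ t, G (circlePoint t) ∂σ =
      ∫ x in (0 : ℝ)..1, G (circleMap 0 1 (2 * Real.pi * x)) := by
    have h := fourierCoeff_eq_intervalIntegral (T := 1) (fun t => G (circlePoint t)) 0 0
    simp only [fourierCoeff, neg_zero, fourier_zero, one_smul, div_one, zero_add] at h
    rw [h]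
    refine intervalIntegral.integral_congr fun x _ => ?_
    simp [circlePoint, AddCircle.toCircle_apply_mk, circleMap]
  have h_subst := intervalIntegral.integral_comp_mul_left (a := 0) (b := 1)
    (fun θ => G (circleMap 0 1 θ)) (c := 2 * Real.pi) (by positivity)
  rw [h_interval, h_subst, Real.circleAverage_def, mul_zero, mul_one]

lemma ae_circlePoint_ne (z : ℂ) : ∀ᵐ t ∂σ, circlePoint t ≠ z := by
  have h_nontrivial : Nontrivial UnitAddCircle := ⟨((2⁻¹ : ℝ) : UnitAddCircle), 0, fun h => by
    have h_toCircle := congrArg circlePoint h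
    rw [circlePoint, circlePoint, AddCircle.toCircle_apply_mk, AddCircle.toCircle_zero,
      Circle.coe_exp, show 2 * Real.pi / (1 : ℝ) * 2⁻¹ = Real.pi by ring,
      Complex.exp_pi_mul_I] at h_toCircle
    norm_num at h_toCircle⟩
  have : (𝓝[≠] (0 : UnitAddCircle)).NeBot := inferInstance
  have h_inj : Function.Injective circlePoint :=
    Subtype.val_injective.comp (AddCircle.injective_toCircle one_ne_zero)
  exact measure_eq_zero_iff_ae_notMem.mp
    ((subsingleton_singleton.preimage h_inj).measure_zero σ : σ (circlePoint ⁻¹' {z}) = 0)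

end Circle

section DiscAlgebra

/-- Membership in the disc algebra: `F` is holomorphic on the open unit disc and continuous up to
the unit circle. -/
abbrev InDiscAlgebra (F : ℂ → ℂ) : Prop := DiffContOnCl ℂ F (Metric.ball 0 1)

namespace InDiscAlgebra

variable {F G : ℂ → ℂ}

lemma mul (hF : InDiscAlgebra F) (hG : InDiscAlgebra G) : InDiscAlgebra fun z => F z * G z :=
  hF.smul hG

lemma exists_bound (hF : InDiscAlgebra F) : ∃ M, ∀ z, ‖z‖ ≤ 1 → ‖F z‖ ≤ M := by
  obtain ⟨M, hM⟩ := (isCompact_closedBall (0 : ℂ) 1).exists_bound_of_continuousOn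
    hF.continuousOn_ball
  exact ⟨M, fun z hz => hM z (by simpa using hz)⟩

lemma continuous_comp_circlePoint (hF : InDiscAlgebra F) :
    Continuous fun t => F (circlePoint t) :=
  hF.continuousOn_ball.comp_continuous continuous_circlePoint fun t => by simp [norm_circlePoint]

lemma integral_comp_circlePoint (hF : InDiscAlgebra F) : ∫ t, F (circlePoint t) ∂σ = F 0 := by
  rw [DBR.integral_comp_circlePoint]
  exact DiffContOnCl.circleAverage (by rwa [abs_one])

lemma hasSum_integral_mul_pow (hF : InDiscAlgebra F) {w : ℂ} (hw : ‖w‖ < 1) :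
    HasSum (fun n : ℕ => (∫ t, fourier (-(n : ℤ)) t * F (circlePoint t) ∂σ) * w ^ n) (F w) := by
  have h_term (n : ℕ) : (cauchyPowerSeries F 0 (1 : NNReal) n fun _ => w) =
      (∫ t, fourier (-(n : ℤ)) t * F (circlePoint t) ∂σ) * w ^ n := by
    have h_average := DBR.integral_comp_circlePoint fun z => (w / z) ^ n * F z
    rw [Real.circleAverage_eq_circleIntegral one_ne_zero] at h_average
    simp only [cauchyPowerSeries_apply, sub_zero, smul_eq_mul, NNReal.coe_one,
      mul_left_comm] at h_average ⊢
    rw [← h_average, ← integral_mul_const]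
    refine integral_congr_ae (Eventually.of_forall fun t => ?_)
    simp only [fourier_eq_circlePoint_zpow, zpow_neg, zpow_natCast, div_pow]
    ring
  have h_series := (hF.hasFPowerSeriesOnBall (R := 1) one_pos).hasSum (y := w)
    (by simpa [← ofReal_norm] using hw)
  simpa only [h_term, zero_add] using h_series

end InDiscAlgebra

end DiscAlgebra

section BoundaryFunctions

/-- `F` represents an element of `H^∞`: its values on the open unit disc, and its boundary values
at almost every point of the unit circle, are the limits of a uniformly bounded sequence in the
disc algebra. One function carries both the values inside the disc and the boundary values. -/
def IsHInf (F : ℂ → ℂ) : Prop :=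
  ∃ (M : ℝ) (u : ℕ → ℂ → ℂ), (∀ N, InDiscAlgebra (u N)) ∧ (∀ N z, ‖z‖ ≤ 1 → ‖u N z‖ ≤ M) ∧
    (∀ z, ‖z‖ < 1 → Tendsto (fun N => u N z) atTop (𝓝 (F z))) ∧
    ∀ᵐ t ∂σ, Tendsto (fun N => u N (circlePoint t)) atTop (𝓝 (F (circlePoint t)))

lemma InDiscAlgebra.isHInf {F : ℂ → ℂ} (hF : InDiscAlgebra F) : IsHInf F := by
  obtain ⟨M, hM⟩ := hF.exists_bound
  exact ⟨M, fun _ => F, fun _ => hF, fun _ => hM, fun _ _ => tendsto_const_nhds,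
    Eventually.of_forall fun _ => tendsto_const_nhds⟩

lemma norm_hardy_le_of_ae_norm_le {p : ℝ≥0∞} [Fact (1 ≤ p)] {f : hardy p} {C : ℝ} (hC : 0 ≤ C)
    (h : ∀ᵐ t ∂σ, ‖(f : LpT p) t‖ ≤ C) : ‖f‖ ≤ C := by
  simpa [measureUnivNNReal] using Lp.norm_le_of_ae_bound hC h

namespace IsHInf

variable {F G : ℂ → ℂ}

lemma mul (hF : IsHInf F) (hG : IsHInf G) : IsHInf fun z => F z * G z := by
  obtain ⟨M, u, hu, hM, hu_disc, hu_circle⟩ := hF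
  obtain ⟨K, v, hv, hK, hv_disc, hv_circle⟩ := hG
  refine ⟨M * K, fun N z => u N z * v N z, fun N => (hu N).mul (hv N), fun N z hz => ?_,
    fun z hz => (hu_disc z hz).mul (hv_disc z hz), ?_⟩
  · rw [norm_mul]
    exact mul_le_mul (hM N z hz) (hK N z hz) (norm_nonneg _) ((norm_nonneg _).trans (hM N z hz))
  · filter_upwards [hu_circle, hv_circle] with t hut hvt using hut.mul hvt

lemma memLp (hF : IsHInf F) (p : ℝ≥0∞) : MemLp (fun t => F (circlePoint t)) p σ := by
  obtain ⟨M, u, hu, hM, -, hu_circle⟩ := hF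
  refine MemLp.of_bound (aestronglyMeasurable_of_tendsto_ae atTop
    (fun N => (hu N).continuous_comp_circlePoint.aestronglyMeasurable) hu_circle) M ?_
  filter_upwards [hu_circle] with t ht
  exact le_of_tendsto ht.norm (Eventually.of_forall fun N => hM N _ (norm_circlePoint t).le)

lemma exists_tendsto_integral_mul (hF : IsHInf F) : ∃ u : ℕ → ℂ → ℂ, (∀ N, InDiscAlgebra (u N)) ∧
    (∀ z, ‖z‖ < 1 → Tendsto (fun N => u N z) atTop (𝓝 (F z))) ∧
    ∀ g : UnitAddCircle → ℂ, Integrable g σ →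
      Tendsto (fun N => ∫ t, g t * u N (circlePoint t) ∂σ) atTop
        (𝓝 (∫ t, g t * F (circlePoint t) ∂σ)) := by
  obtain ⟨M, u, hu, hM, hu_disc, hu_circle⟩ := hF
  refine ⟨u, hu, hu_disc, fun g hg =>
    tendsto_integral_of_dominated_convergence (fun t => ‖g t‖ * M)
      (fun N => hg.1.mul (hu N).continuous_comp_circlePoint.aestronglyMeasurable)
      (hg.norm.mul_const M) (fun N => Eventually.of_forall fun t => ?_) ?_⟩
  · rw [norm_mul]
    exact mul_le_mul_of_nonneg_left (hM N _ (norm_circlePoint t).le) (norm_nonneg _)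
  · filter_upwards [hu_circle] with t ht using ht.const_mul _

lemma integral_comp_circlePoint (hF : IsHInf F) : ∫ t, F (circlePoint t) ∂σ = F 0 := by
  obtain ⟨u, hu, hu_disc, hu_integral⟩ := hF.exists_tendsto_integral_mul
  have h_limit := hu_integral (fun _ => 1) (integrable_const 1)
  simp only [one_mul, (hu _).integral_comp_circlePoint] at h_limit
  exact tendsto_nhds_unique h_limit (hu_disc 0 (by simp))

/-- The boundary function of `F`, as an element of `H^p`. -/
def boundary (hF : IsHInf F) (p : ℝ≥0∞) [Fact (1 ≤ p)] : hardy p :=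
  ⟨(hF.memLp p).toLp, fun n hn => by
    obtain ⟨m, rfl⟩ : ∃ m : ℕ, n = -(m + 1 : ℕ) := ⟨(-n - 1).toNat, by omega⟩
    change fourierCoeff _ _ = 0
    have h_pow : IsHInf fun z => z ^ (m + 1) :=
      InDiscAlgebra.isHInf (differentiable_pow _).diffContOnCl
    rw [fourierCoeff_congr_ae (hF.memLp p).coeFn_toLp, fourierCoeff]
    simp_rw [neg_neg, fourier_eq_circlePoint_zpow, zpow_natCast, smul_eq_mul]
    rw [(h_pow.mul hF).integral_comp_circlePoint, zero_pow m.succ_ne_zero, zero_mul]⟩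

lemma coeFn_boundary (hF : IsHInf F) (p : ℝ≥0∞) [Fact (1 ≤ p)] :
    (hF.boundary p : LpT p) =ᵐ[σ] fun t => F (circlePoint t) :=
  (hF.memLp p).coeFn_toLp

lemma coeff_boundary (hF : IsHInf F) (p : ℝ≥0∞) [Fact (1 ≤ p)] (n : ℤ) :
    coeff p n (hF.boundary p : LpT p) = ∫ t, fourier (-n) t * F (circlePoint t) ∂σ :=
  congrFun (fourierCoeff_congr_ae (hF.coeFn_boundary p)) n

lemma boundary_ne_zero (hF : IsHInf F) (p : ℝ≥0∞) [Fact (1 ≤ p)] (hF_zero : F 0 ≠ 0) :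
    hF.boundary p ≠ 0 := by
  intro h
  have h_coeff := hF.coeff_boundary p 0
  simp only [h, ZeroMemClass.coe_zero, map_zero, neg_zero, fourier_zero, one_mul,
    hF.integral_comp_circlePoint] at h_coeff
  exact hF_zero h_coeff.symm

end IsHInf

end BoundaryFunctions

section SzegoKernel

/-- The Szegő kernel `k_w(z) = (1 - w̄ z)⁻¹` for `‖w‖ < 1`, which reproduces the values at `w` of
the functions in `H²`, given by its power series. -/
def szego (w : ℂ) : H2 := ∑' n : ℕ, conj w ^ n • monomial n

lemma coeff_eq_inner_monomial (f : H2) (n : ℕ) :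
    coeff 2 n (f : LpT 2) = inner ℂ (monomial n) f :=
  coeff_two_eq_inner _ _

lemma norm_conj_pow_smul_monomial (w : ℂ) (n : ℕ) : ‖conj w ^ n • monomial n‖ = ‖w‖ ^ n := by
  rw [norm_smul, norm_monomial, mul_one, norm_pow, RCLike.norm_conj]

variable {w : ℂ}

lemma hasSum_szego (hw : ‖w‖ < 1) : HasSum (fun n : ℕ => conj w ^ n • monomial n) (szego w) := by
  refine (Summable.of_norm ?_).hasSum
  simpa only [norm_conj_pow_smul_monomial] using summable_geometric_of_lt_one (norm_nonneg w) hw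

lemma norm_szego_le (hw : ‖w‖ < 1) : ‖szego w‖ ≤ (1 - ‖w‖)⁻¹ :=
  tsum_of_norm_bounded (hasSum_geometric_of_lt_one (norm_nonneg w) hw) fun n =>
    (norm_conj_pow_smul_monomial w n).le

lemma hasSum_eval (f : H2) (hw : ‖w‖ < 1) :
    HasSum (fun n : ℕ => coeff 2 n (f : LpT 2) * w ^ n) (eval f w) :=
  (summable_coeff f hw).of_norm.hasSum

lemma inner_szego (f : H2) (hw : ‖w‖ < 1) : inner ℂ (szego w) f = eval f w := by
  have h_term (n : ℕ) : inner ℂ f (conj w ^ n • monomial n) =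
      conj (coeff 2 n (f : LpT 2) * w ^ n) := by
    rw [inner_smul_right (E := H2), ← inner_conj_symm (E := H2), ← coeff_eq_inner_monomial,
      map_mul, map_pow, mul_comm]
  have h_sum := (hasSum_szego hw).mapL (innerSL ℂ f)
  simp only [innerSL_apply_apply, h_term] at h_sum
  rw [← inner_conj_symm (E := H2), h_sum.unique (Complex.hasSum_conj'.mpr (hasSum_eval f hw)),
    Complex.conj_conj]

lemma eq_of_forall_coeff_eq {f g : H2}
    (h : ∀ n : ℕ, coeff 2 n (f : LpT 2) = coeff 2 n (g : LpT 2)) : f = g := by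
  refine Subtype.ext (fourierBasis.repr.injective (lp.ext (funext fun n => ?_)))
  rw [fourierBasis_repr, fourierBasis_repr]
  rcases lt_or_ge n 0 with hn | hn
  · exact (f.2 n hn).trans (g.2 n hn).symm
  · lift n to ℕ using hn
    exact h n

lemma eq_of_forall_eval_eq {f g : H2} (h : ∀ z, ‖z‖ < 1 → eval f z = eval g z) : f = g := by
  have h_ball : ∀ᶠ z : ℂ in 𝓝 0, ‖z‖ < 1 := by
    simpa using
      Metric.eventually_nhds_iff_ball.mpr ⟨1, one_pos, fun z hz => mem_ball_zero_iff.mp hz⟩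
  have h_series (φ : H2) : HasFPowerSeriesAt (eval φ)
      (.ofScalars ℂ fun n : ℕ => coeff 2 n (φ : LpT 2)) 0 := by
    refine hasFPowerSeriesAt_iff.mpr ?_
    filter_upwards [h_ball] with z hz
    simpa [FormalMultilinearSeries.coeff_ofScalars, mul_comm] using hasSum_eval φ hz
  have h_eq := (h_series f).eq_formalMultilinearSeries
    ((h_series g).congr (by filter_upwards [h_ball] with z hz using (h z hz).symm))
  refine eq_of_forall_coeff_eq fun n => ?_
  simpa [FormalMultilinearSeries.coeff_ofScalars] using congrArg (·.coeff n) h_eq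

lemma InDiscAlgebra.eval_boundary {F : ℂ → ℂ} (hF : InDiscAlgebra F) (hw : ‖w‖ < 1) :
    eval (hF.isHInf.boundary 2) w = F w := by
  refine (hasSum_eval _ hw).unique ?_
  simpa only [hF.isHInf.coeff_boundary] using hF.hasSum_integral_mul_pow hw

lemma inner_boundary {F : ℂ → ℂ} (hF : IsHInf F) (f : H2) :
    inner ℂ f (hF.boundary 2) = ∫ t, conj ((f : LpT 2) t) * F (circlePoint t) ∂σ := by
  change inner ℂ (f : LpT 2) (hF.boundary 2 : LpT 2) = _
  rw [L2.inner_def]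
  refine integral_congr_ae ?_
  filter_upwards [hF.coeFn_boundary 2] with t ht
  rw [ht, RCLike.inner_apply']

lemma eval_boundary {F : ℂ → ℂ} (hF : IsHInf F) (hw : ‖w‖ < 1) :
    eval (hF.boundary 2) w = F w := by
  obtain ⟨u, hu, hu_disc, hu_integral⟩ := hF.exists_tendsto_integral_mul
  have h_limit := hu_integral (fun t => conj ((szego w : LpT 2) t))
    ((Lp.memLp (szego w : LpT 2)).star.integrable one_le_two)
  simp only [← inner_boundary (hu _).isHInf, ← inner_boundary hF, inner_szego _ hw,
    (hu _).eval_boundary hw] at h_limit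
  exact tendsto_nhds_unique h_limit (hu_disc w hw)

end SzegoKernel

section Toeplitz

variable {F G : ℂ → ℂ}

lemma toeplitz_eq_of_mulOp_eq {ψ : LpT ∞} {f g : H2} (h : mulOp ψ f = g) :
    toeplitz ψ f = g :=
  (congrArg (hardy 2).orthogonalProjectionOnto h).trans
    (Submodule.orthogonalProjectionOnto_mem_subspace_eq_self g)

lemma toeplitz_boundary (hF : IsHInf F) (hG : IsHInf G) :
    toeplitz (hF.boundary ∞ : LpT ∞) (hG.boundary 2) = (hF.mul hG).boundary 2 := by
  refine toeplitz_eq_of_mulOp_eq (Lp.ext ?_)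
  filter_upwards [mulOp_coe (hF.boundary ∞ : LpT ∞) (hG.boundary 2 : LpT 2), hF.coeFn_boundary ∞,
    hG.coeFn_boundary 2, (hF.mul hG).coeFn_boundary 2] with t h_mul hFt hGt hFGt
  rw [h_mul, hFt, hGt, hFGt]

lemma isHInf_pow (n : ℕ) : IsHInf fun z => z ^ n :=
  InDiscAlgebra.isHInf (differentiable_pow n).diffContOnCl

lemma monomial_eq_boundary (n : ℕ) : monomial n = (isHInf_pow n).boundary 2 := by
  refine Subtype.ext (Lp.ext ?_)
  filter_upwards [coeFn_fourierLp 2 (n : ℤ), (isHInf_pow n).coeFn_boundary 2] with t h_fourier h_pow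
  rw [h_pow]
  refine h_fourier.trans ?_
  rw [fourier_eq_circlePoint_zpow, zpow_natCast]

lemma toeplitz_star_szego (hF : IsHInf F) {w : ℂ} (hw : ‖w‖ < 1) :
    toeplitz (star (hF.boundary ∞ : LpT ∞)) (szego w) = conj (F w) • szego w := by
  have h_inner {H : ℂ → ℂ} (hH : IsHInf H) : inner ℂ (hH.boundary 2) (szego w) = conj (H w) := by
    rw [← inner_conj_symm (E := H2), inner_szego _ hw, eval_boundary hH hw]
  refine eq_of_forall_coeff_eq fun n => ?_
  rw [coeff_eq_inner_monomial, coeff_eq_inner_monomial, ← inner_toeplitz,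
    inner_smul_right (E := H2), monomial_eq_boundary, toeplitz_boundary hF, h_inner, h_inner,
    map_mul]

lemma eval_toeplitz (hF : IsHInf F) (f : H2) {w : ℂ} (hw : ‖w‖ < 1) :
    eval (toeplitz (hF.boundary ∞ : LpT ∞) f) w = F w * eval f w := by
  rw [← inner_szego _ hw, ← inner_conj_symm (E := H2), inner_toeplitz, toeplitz_star_szego hF hw,
    inner_conj_symm (E := H2), inner_smul_left (E := H2), Complex.conj_conj, inner_szego _ hw]

end Toeplitz

section RangeSpace

variable {b : HInf} {f : H2}

lemma isSelfAdjoint_defectSqrt (b : HInf) : IsSelfAdjoint (defectSqrt b) :=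
  (opSqrt_isPositive (defect b)).isSelfAdjoint

lemma inner_defectSqrt (b : HInf) (x y : H2) :
    inner ℂ (defectSqrt b x) y = inner ℂ x (defectSqrt b y) :=
  (opSqrt_isPositive (defect b)).isSymmetric x y

lemma re_inner_self (x : H2) : (inner ℂ x x).re = ‖x‖ ^ 2 :=
  (norm_sq_eq_re_inner (𝕜 := ℂ) (E := H2) x).symm

lemma defect_apply (b : HInf) (x : H2) :
    defect b x = x - toeplitz (b : LpT ∞) (toeplitz (star (b : LpT ∞)) x) :=
  rfl

lemma defectSqrt_defectSqrt (hb : ‖b‖ ≤ 1) (x : H2) : defectSqrt b (defectSqrt b x) = defect b x :=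
  DFunLike.congr_fun (defectSqrt_mul_self b hb) x

lemma norm_defectSqrt_sq (hb : ‖b‖ ≤ 1) (x : H2) :
    ‖defectSqrt b x‖ ^ 2 = ‖x‖ ^ 2 - ‖toeplitz (star (b : LpT ∞)) x‖ ^ 2 := by
  rw [← re_inner_self, inner_defectSqrt, defectSqrt_defectSqrt hb, defect_apply,
    inner_sub_right (E := H2), Complex.sub_re, re_inner_self, ← re_inner_self (toeplitz _ _),
    inner_toeplitz, star_star]

lemma norm_defectSqrt_toeplitz_sq_le (hb : ‖b‖ ≤ 1) (y : H2) :
    ‖defectSqrt b (toeplitz (b : LpT ∞) y)‖ ^ 2 ≤ ‖y‖ ^ 2 - ‖toeplitz (b : LpT ∞) y‖ ^ 2 := by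
  have h_inner : (inner ℂ y (toeplitz (star (b : LpT ∞)) (toeplitz (b : LpT ∞) y))).re =
      ‖toeplitz (b : LpT ∞) y‖ ^ 2 := by
    rw [← inner_toeplitz, re_inner_self]
  have h_expand := norm_sub_sq (𝕜 := ℂ) (E := H2) y
    (toeplitz (star (b : LpT ∞)) (toeplitz (b : LpT ∞) y))
  rw [RCLike.re_eq_complex_re, h_inner] at h_expand
  rw [norm_defectSqrt_sq hb]
  linarith [sq_nonneg ‖y - toeplitz (star (b : LpT ∞)) (toeplitz (b : LpT ∞) y)‖]

lemma mem_space_of_norm_inner_le {C : ℝ} (hf : ∀ x, ‖inner ℂ f x‖ ≤ C * ‖defectSqrt b x‖) :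
    f ∈ space b := by
  have h_range := mem_range_adjoint_of_norm_inner_le (T := defectSqrt b) hf
  rwa [(isSelfAdjoint_defectSqrt b).adjoint_eq] at h_range

lemma mem_space_of_toeplitz_star_eq_zero (hb : ‖b‖ ≤ 1)
    (hf : toeplitz (star (b : LpT ∞)) f = 0) : f ∈ space b := by
  refine ⟨defectSqrt b f, (defectSqrt_defectSqrt hb f).trans ?_⟩
  rw [defect_apply, hf, map_zero, sub_zero]

lemma norm_inner_le_hbNorm_mul (hf : f ∈ space b) (x : H2) :
    ‖inner ℂ f x‖ ≤ hbNorm b f * ‖defectSqrt b x‖ := by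
  have h_preimage (g : H2) (hg : defectSqrt b g = f) :
      ‖inner ℂ f x‖ ≤ ‖g‖ * ‖defectSqrt b x‖ := by
    rw [← hg, inner_defectSqrt]
    exact norm_inner_le_norm (𝕜 := ℂ) (E := H2) _ _
  obtain ⟨g, hg⟩ := hf
  rcases (norm_nonneg (defectSqrt b x)).eq_or_lt with h_zero | h_pos
  · simpa only [← h_zero, mul_zero] using h_preimage g hg
  · rw [← div_le_iff₀ h_pos]
    refine le_csInf ⟨‖g‖, g, hg, rfl⟩ ?_
    rintro _ ⟨g, hg, rfl⟩
    exact (div_le_iff₀ h_pos).mpr (h_preimage g hg)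

end RangeSpace

section NormIntegrals

lemma norm_sq_eq_integral (f : LpT 2) : ‖f‖ ^ 2 = ∫ t, ‖f t‖ ^ 2 ∂σ := by
  rw [norm_sq_eq_re_inner (𝕜 := ℂ) f, L2.inner_def, ← integral_re (L2.integrable_inner f f)]
  simp only [norm_sq_eq_re_inner (𝕜 := ℂ)]

lemma integrable_norm_sq (f : LpT 2) : Integrable (fun t => ‖f t‖ ^ 2) σ :=
  (Lp.memLp f).integrable_norm_pow two_ne_zero

lemma norm_mulOp_sq_add_le {φ ψ : LpT ∞} (h : ∀ᵐ t ∂σ, ‖φ t‖ ^ 2 + ‖ψ t‖ ^ 2 ≤ 1) (x : LpT 2) :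
    ‖mulOp φ x‖ ^ 2 + ‖mulOp ψ x‖ ^ 2 ≤ ‖x‖ ^ 2 := by
  rw [norm_sq_eq_integral, norm_sq_eq_integral, norm_sq_eq_integral,
    ← integral_add (integrable_norm_sq _) (integrable_norm_sq _)]
  refine integral_mono_ae ((integrable_norm_sq _).add (integrable_norm_sq _))
    (integrable_norm_sq _) ?_
  filter_upwards [h, mulOp_coe φ x, mulOp_coe ψ x] with t ht hφ hψ
  rw [hφ, hψ, norm_mul, norm_mul, mul_pow, mul_pow, ← add_mul]
  exact mul_le_of_le_one_left (sq_nonneg _) ht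

lemma norm_toeplitz_le_norm_mulOp (ψ : LpT ∞) (x : H2) :
    ‖toeplitz ψ x‖ ≤ ‖mulOp ψ (x : LpT 2)‖ :=
  (hardy 2).norm_orthogonalProjectionOnto_apply_le _

lemma norm_toeplitz_le_norm_defectSqrt {b : HInf} (hb : ‖b‖ ≤ 1) {φ : LpT ∞}
    (h : ∀ᵐ t ∂σ, ‖φ t‖ ^ 2 + ‖(b : LpT ∞) t‖ ^ 2 ≤ 1) (x : H2) :
    ‖toeplitz φ x‖ ≤ ‖defectSqrt b x‖ := by
  have h_star : ∀ᵐ t ∂σ, ‖φ t‖ ^ 2 + ‖(star (b : LpT ∞) : LpT ∞) t‖ ^ 2 ≤ 1 := by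
    filter_upwards [h, Lp.coeFn_star (b : LpT ∞)] with t ht ht_star
    rwa [ht_star, Pi.star_apply, norm_star]
  have h_mulOp := norm_mulOp_sq_add_le h_star (x : LpT 2)
  have hφ := pow_le_pow_left₀ (norm_nonneg _) (norm_toeplitz_le_norm_mulOp φ x) 2
  have hb_star := pow_le_pow_left₀ (norm_nonneg _)
    (norm_toeplitz_le_norm_mulOp (star (b : LpT ∞)) x) 2
  refine (sq_le_sq₀ (norm_nonneg _) (norm_nonneg _)).mp ?_
  rw [norm_defectSqrt_sq hb]
  exact le_sub_iff_add_le.mpr ((add_le_add hφ hb_star).trans h_mulOp)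

lemma norm_boundary_sq {F : ℂ → ℂ} (hF : IsHInf F) :
    ‖hF.boundary 2‖ ^ 2 = ∫ t, ‖F (circlePoint t)‖ ^ 2 ∂σ := by
  refine (norm_sq_eq_integral (hF.boundary 2 : LpT 2)).trans (integral_congr_ae ?_)
  filter_upwards [hF.coeFn_boundary 2] with t ht
  rw [ht]

lemma norm_defectSqrt_toeplitz_boundary_le {F Y : ℂ → ℂ} (hF : IsHInf F) (hY : IsHInf Y)
    (hF_norm : ‖hF.boundary ∞‖ ≤ 1)
    (h : ∀ᵐ t ∂σ, (1 - ‖F (circlePoint t)‖ ^ 2) * ‖Y (circlePoint t)‖ ^ 2 ≤ 1) :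
    ‖defectSqrt (hF.boundary ∞) (toeplitz (hF.boundary ∞ : LpT ∞) (hY.boundary 2))‖ ≤ 1 := by
  have h_integrable {G : ℂ → ℂ} (hG : IsHInf G) :
      Integrable (fun t => ‖G (circlePoint t)‖ ^ 2) σ :=
    (hG.memLp 2).integrable_norm_pow two_ne_zero
  refine (sq_le_one_iff₀ (norm_nonneg _)).mp ((norm_defectSqrt_toeplitz_sq_le hF_norm _).trans ?_)
  rw [toeplitz_boundary hF hY, norm_boundary_sq, norm_boundary_sq,
    ← integral_sub (h_integrable hY) (h_integrable (hF.mul hY))]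
  refine (integral_mono_ae ((h_integrable hY).sub (h_integrable (hF.mul hY)))
    (integrable_const 1) ?_).trans (by simp)
  filter_upwards [h] with t ht
  rwa [Pi.sub_apply, norm_mul, mul_pow, ← one_sub_mul]

end NormIntegrals

section Dilates

variable {r : ℝ}

lemma hasSum_dilate (f : H2) (hr : |r| < 1) :
    HasSum (fun n : ℕ => (coeff 2 n (f : LpT 2) * (r : ℂ) ^ n) • monomial n) (dilate f r) := by
  refine (Summable.of_norm ?_).hasSum
  simpa only [norm_smul, norm_monomial, mul_one] using
    summable_coeff f (z := (r : ℂ)) (by simpa using hr)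

lemma inner_dilate (f g : H2) (hr : |r| < 1) :
    inner ℂ (dilate f r) g = inner ℂ f (dilate g r) := by
  have h_left := (hasSum_dilate f hr).mapL (innerSL ℂ g)
  have h_right := (hasSum_dilate g hr).mapL (innerSL ℂ f)
  have h_conj (φ : H2) (n : ℕ) : inner ℂ φ (monomial n) = conj (coeff 2 n (φ : LpT 2)) := by
    rw [coeff_eq_inner_monomial, inner_conj_symm (E := H2)]
  simp only [innerSL_apply_apply, inner_smul_right (E := H2), h_conj] at h_left h_right
  rw [← inner_conj_symm (E := H2), ← h_left.tsum_eq, Complex.conj_tsum, ← h_right.tsum_eq]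
  refine tsum_congr fun n => ?_
  simp only [map_mul, map_pow, Complex.conj_conj, Complex.conj_ofReal]
  ring

lemma norm_dilate_le (f : H2) (hr : |r| < 1) : ‖dilate f r‖ ≤ ‖f‖ * (1 - |r|)⁻¹ := by
  refine (hasSum_dilate f hr).norm_le_of_bounded
    ((hasSum_geometric_of_lt_one (abs_nonneg r) hr).mul_left ‖f‖) fun n => ?_
  rw [norm_smul, norm_monomial, mul_one, norm_mul, norm_pow, Complex.norm_real, Real.norm_eq_abs]
  exact mul_le_mul_of_nonneg_right (norm_coeff_le f n) (by positivity)

lemma norm_ofReal_mul_lt_one (hr : |r| < 1) {z : ℂ} (hz : ‖z‖ ≤ 1) : ‖(r : ℂ) * z‖ < 1 := by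
  rw [norm_mul, Complex.norm_real, Real.norm_eq_abs]
  nlinarith [abs_nonneg r]

lemma InDiscAlgebra.inv_comp_ofReal_mul {A : ℂ → ℂ} (hA : InDiscAlgebra A)
    (hA_ne : ∀ z, ‖z‖ < 1 → A z ≠ 0) (hr : |r| < 1) : InDiscAlgebra fun z => (A (r * z))⁻¹ := by
  refine DifferentiableOn.diffContOnCl fun z hz => ?_
  rw [closure_ball _ one_ne_zero, mem_closedBall_zero_iff] at hz
  have h_mem := norm_ofReal_mul_lt_one hr hz
  have hA_diff : DifferentiableAt ℂ A (r * z) :=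
    hA.differentiableAt Metric.isOpen_ball (by simpa using h_mem)
  exact ((hA_diff.comp z (by fun_prop)).inv (hA_ne _ h_mem)).differentiableWithinAt

/-- Dilation is self-adjoint, `x_r = T_{1/A_r} (T_A x)_r`, and `‖T_A x‖ ≤ ‖defectSqrt b x‖`. -/
lemma dilate_mem_space {b : HInf} (hb : ‖b‖ ≤ 1) {A : ℂ → ℂ} (hA : InDiscAlgebra A)
    (hA_ne : ∀ z, ‖z‖ < 1 → A z ≠ 0)
    (hA_norm : ∀ᵐ t ∂σ, ‖A (circlePoint t)‖ ^ 2 + ‖(b : LpT ∞) t‖ ^ 2 ≤ 1)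
    (f : H2) (hr : |r| < 1) : dilate f r ∈ space b := by
  have hA_inv := (hA.inv_comp_ofReal_mul hA_ne hr).isHInf
  set T_A := toeplitz (hA.isHInf.boundary ∞ : LpT ∞)
  set T_inv := toeplitz (hA_inv.boundary ∞ : LpT ∞)
  have h_factor (x : H2) : dilate x r = T_inv (dilate (T_A x) r) := by
    refine eq_of_forall_eval_eq fun z hz => ?_
    have h_mem := norm_ofReal_mul_lt_one hr hz.le
    rw [eval_toeplitz hA_inv _ hz, eval_dilate _ hr, eval_dilate _ hr,
      eval_toeplitz hA.isHInf _ h_mem, inv_mul_cancel_left₀ (hA_ne _ h_mem)]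
  have h_contraction (x : H2) : ‖T_A x‖ ≤ ‖defectSqrt b x‖ := by
    refine norm_toeplitz_le_norm_defectSqrt hb ?_ x
    filter_upwards [hA_norm, hA.isHInf.coeFn_boundary ∞] with t ht h_eq
    rwa [h_eq]
  have h_inv_nonneg : 0 ≤ (1 - |r|)⁻¹ := inv_nonneg.mpr (sub_nonneg.mpr hr.le)
  refine mem_space_of_norm_inner_le (C := ‖f‖ * (‖T_inv‖ * (1 - |r|)⁻¹)) fun x => ?_
  calc ‖inner ℂ (dilate f r) x‖
      ≤ ‖f‖ * ‖T_inv (dilate (T_A x) r)‖ := by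
        rw [inner_dilate f x hr, h_factor]
        exact norm_inner_le_norm (𝕜 := ℂ) (E := H2) _ _
    _ ≤ ‖f‖ * (‖T_inv‖ * (‖defectSqrt b x‖ * (1 - |r|)⁻¹)) := by
        gcongr
        refine (T_inv.le_opNorm _).trans ?_
        gcongr
        exact (norm_dilate_le _ hr).trans
          (mul_le_mul_of_nonneg_right (h_contraction x) h_inv_nonneg)
    _ = ‖f‖ * (‖T_inv‖ * (1 - |r|)⁻¹) * ‖defectSqrt b x‖ := by ring

end Dilates

section KernelSeries

variable {ι : Type*} {c : ι → ℝ} {w : ι → ℂ} {f : H2} {F Y : ℂ → ℂ} {r : ℝ}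

lemma toeplitz_star_eq_zero_of_hasSum_szego (hF : IsHInf F) (hw : ∀ i, ‖w i‖ < 1)
    (hFw : ∀ i, F (w i) = 0) (hf : HasSum (fun i => (c i : ℂ) • szego (w i)) f) :
    toeplitz (star (hF.boundary ∞ : LpT ∞)) f = 0 := by
  have h_sum := hf.mapL (toeplitz (star (hF.boundary ∞ : LpT ∞)))
  simp only [map_smul, toeplitz_star_szego hF (hw _), hFw, map_zero, zero_smul,
    smul_zero] at h_sum
  exact h_sum.unique hasSum_zero

lemma hasSum_inner_dilate_of_hasSum_szego (hw : ∀ i, ‖w i‖ < 1)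
    (hf : HasSum (fun i => (c i : ℂ) • szego (w i)) f) (hr : |r| < 1) (x : H2) :
    HasSum (fun i => (c i : ℂ) * eval x (r * w i)) (inner ℂ (dilate f r) x) := by
  have h_sum := Complex.hasSum_conj'.mpr (hf.mapL (innerSL ℂ (dilate x r)))
  simp only [innerSL_apply_apply, inner_smul_right (E := H2), map_mul, Complex.conj_ofReal,
    inner_conj_symm (E := H2), inner_szego _ (hw _), eval_dilate _ hr] at h_sum
  rwa [inner_dilate f x hr]

open scoped ComplexOrder in
/-- The dilate is tested against `T_F Y`, to which all the kernels contribute nonnegatively. -/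
lemma mul_norm_le_hbNorm_dilate (hF : IsHInf F) (hF_norm : ‖hF.boundary ∞‖ ≤ 1) (hY : IsHInf Y)
    (hY_weight : ∀ᵐ t ∂σ, (1 - ‖F (circlePoint t)‖ ^ 2) * ‖Y (circlePoint t)‖ ^ 2 ≤ 1)
    (hc : ∀ i, 0 ≤ c i) (hw : ∀ i, ‖w i‖ < 1)
    (hf : HasSum (fun i => (c i : ℂ) • szego (w i)) f) (hr : |r| < 1)
    (hf_mem : dilate f r ∈ space (hF.boundary ∞))
    (h_nonneg : ∀ i, 0 ≤ F (r * w i) * Y (r * w i)) (i : ι) :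
    c i * ‖F (r * w i) * Y (r * w i)‖ ≤ hbNorm (hF.boundary ∞) (dilate f r) := by
  set x := toeplitz (hF.boundary ∞ : LpT ∞) (hY.boundary 2) with hx
  have h_eval (j : ι) : eval x (r * w j) = F (r * w j) * Y (r * w j) := by
    rw [hx, toeplitz_boundary hF hY,
      eval_boundary (hF.mul hY) (norm_ofReal_mul_lt_one hr (hw j).le)]
  have h_sum := hasSum_inner_dilate_of_hasSum_szego hw hf hr x
  simp only [h_eval] at h_sum
  have h_term_nonneg (j : ι) : 0 ≤ (c j : ℂ) * (F (r * w j) * Y (r * w j)) :=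
    mul_nonneg (Complex.zero_le_real.mpr (hc j)) (h_nonneg j)
  calc c i * ‖F (r * w i) * Y (r * w i)‖
      = ((c i : ℂ) * (F (r * w i) * Y (r * w i))).re := by
        rw [Complex.re_ofReal_mul, ← Complex.re_eq_norm.mpr (h_nonneg i)]
    _ ≤ (inner ℂ (dilate f r) x).re :=
        (Complex.le_def.mp (le_hasSum h_sum i fun j _ => h_term_nonneg j)).1
    _ ≤ ‖inner ℂ (dilate f r) x‖ := Complex.re_le_norm _
    _ ≤ hbNorm (hF.boundary ∞) (dilate f r) * ‖defectSqrt (hF.boundary ∞) x‖ :=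
        norm_inner_le_hbNorm_mul hf_mem x
    _ ≤ hbNorm (hF.boundary ∞) (dilate f r) := by
        refine mul_le_of_le_one_right (Real.sInf_nonneg ?_)
          (norm_defectSqrt_toeplitz_boundary_le hF hY hF_norm hY_weight)
        rintro _ ⟨g, -, rfl⟩
        exact norm_nonneg g

end KernelSeries

section NonExtreme

lemma notMem_extremePoints_of_add_mem_of_sub_mem {E : Type*} [AddCommGroup E] [Module ℝ E]
    {s : Set E} {x v : E} (hv : v ≠ 0) (h_add : x + v ∈ s) (h_sub : x - v ∈ s) :
    x ∉ s.extremePoints ℝ := fun hx =>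
  hv <| add_eq_left.mp <|
    hx.2 h_add h_sub ⟨2⁻¹, 2⁻¹, by norm_num, by norm_num, by norm_num, by module⟩

lemma nonExtreme_of_norm_add_le {b g : HInf} (hg : g ≠ 0)
    (h : ∀ᵐ t ∂σ, ‖(b : LpT ∞) t‖ + ‖(g : LpT ∞) t‖ ≤ 1) : NonExtreme b := by
  have mem_of_le (u : HInf) (hu : ∀ᵐ t ∂σ, ‖(u : LpT ∞) t‖ ≤ ‖(b : LpT ∞) t‖ + ‖(g : LpT ∞) t‖) :
      u ∈ Metric.closedBall (0 : HInf) 1 := by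
    refine mem_closedBall_zero_iff.mpr (norm_hardy_le_of_ae_norm_le zero_le_one ?_)
    filter_upwards [h, hu] with t ht hut using hut.trans ht
  refine ⟨mem_of_le b (Eventually.of_forall fun t => by simp),
    notMem_extremePoints_of_add_mem_of_sub_mem hg (mem_of_le _ ?_) (mem_of_le _ ?_)⟩
  · filter_upwards [Lp.coeFn_add (b : LpT ∞) (g : LpT ∞)] with t ht
    exact (congrArg norm ht).trans_le (norm_add_le _ _)
  · filter_upwards [Lp.coeFn_sub (b : LpT ∞) (g : LpT ∞)] with t ht
    exact (congrArg norm ht).trans_le (norm_sub_le _ _)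

end NonExtreme

section PowerSums

variable {ι : Type*}

/-- The sum `∑ᵢ dᵢ z ^ mᵢ` of a family of monomials with real coefficients. -/
def powerSum (d : ι → ℝ) (m : ι → ℕ) (z : ℂ) : ℂ := ∑' i, (d i : ℂ) * z ^ m i

variable {d : ι → ℝ} (m : ι → ℕ) {z : ℂ}

lemma norm_ofReal_mul_pow_le (i : ι) (hz : ‖z‖ ≤ 1) : ‖(d i : ℂ) * z ^ m i‖ ≤ |d i| := by
  rw [norm_mul, norm_pow, Complex.norm_real, Real.norm_eq_abs]
  exact mul_le_of_le_one_right (abs_nonneg _) (pow_le_one₀ (norm_nonneg _) hz)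

lemma summable_ofReal_mul_pow (hd : Summable fun i => |d i|) (hz : ‖z‖ ≤ 1) :
    Summable fun i => (d i : ℂ) * z ^ m i :=
  Summable.of_norm_bounded hd fun i => norm_ofReal_mul_pow_le m i hz

lemma inDiscAlgebra_powerSum (hd : Summable fun i => |d i|) : InDiscAlgebra (powerSum d m) := by
  constructor
  · exact Complex.differentiableOn_tsum_of_summable_norm hd (fun i => by fun_prop)
      Metric.isOpen_ball fun i w hw => norm_ofReal_mul_pow_le m i (mem_ball_zero_iff.mp hw).le
  · rw [closure_ball _ one_ne_zero]
    exact continuousOn_tsum (fun i => by fun_prop) hd fun i w hw =>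
      norm_ofReal_mul_pow_le m i (mem_closedBall_zero_iff.mp hw)

lemma conj_powerSum : conj (powerSum d m z) = powerSum d m (conj z) := by
  simp only [powerSum, Complex.conj_tsum, map_mul, map_pow, Complex.conj_ofReal]

/-- The real part, on the circle, of this function is `‖powerSum c m z‖²`, although it is
holomorphic: in the double sum, `z ^ j * conj z ^ k` is replaced by `z ^ |j - k|`. -/
def normSqSeries (c : ι → ℝ) (m : ι → ℕ) : ℂ → ℂ :=
  powerSum (fun p : ι × ι => c p.1 * c p.2) fun p => Nat.dist (m p.1) (m p.2)

lemma re_pow_dist (hz : ‖z‖ = 1) (j k : ℕ) :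
    (z ^ Nat.dist j k).re = (z ^ j * conj z ^ k).re := by
  have h_mul_conj (i : ℕ) : z ^ i * conj z ^ i = 1 := by
    rw [← mul_pow, Complex.mul_conj, Complex.normSq_eq_norm_sq, hz]
    simp
  rcases le_total k j with h | h
  · obtain ⟨l, rfl⟩ := Nat.exists_eq_add_of_le' h
    rw [Nat.dist_eq_sub_of_le_right h, Nat.add_sub_cancel, pow_add, mul_assoc, h_mul_conj, mul_one]
  · obtain ⟨l, rfl⟩ := Nat.exists_eq_add_of_le h
    rw [Nat.dist_eq_sub_of_le h, Nat.add_sub_cancel_left, pow_add, ← mul_assoc, h_mul_conj,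
      one_mul, ← map_pow, Complex.conj_re]

lemma summable_abs_mul_abs (hd : Summable fun i => |d i|) :
    Summable fun p : ι × ι => |d p.1 * d p.2| := by
  simp only [abs_mul]
  exact hd.mul_of_nonneg hd (fun _ => abs_nonneg _) fun _ => abs_nonneg _

lemma re_normSqSeries (hd : Summable fun i => |d i|) (hz : ‖z‖ = 1) :
    (normSqSeries d m z).re = ‖powerSum d m z‖ ^ 2 := by
  have h_summable := summable_ofReal_mul_pow m hd hz.le
  have h_summable_conj : Summable fun i => (d i : ℂ) * conj z ^ m i :=
    summable_ofReal_mul_pow m hd ((RCLike.norm_conj z).trans_le hz.le)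
  have h_normSq : ‖powerSum d m z‖ ^ 2 = (powerSum d m z * powerSum d m (conj z)).re := by
    rw [← conj_powerSum, Complex.mul_conj, Complex.ofReal_re, Complex.normSq_eq_norm_sq]
  rw [h_normSq, powerSum, powerSum, normSqSeries, powerSum,
    tsum_mul_tsum_of_summable_norm h_summable.norm h_summable_conj.norm,
    Complex.re_tsum (summable_ofReal_mul_pow _ (summable_abs_mul_abs hd) hz.le),
    Complex.re_tsum (summable_mul_of_summable_norm h_summable.norm h_summable_conj.norm)]
  refine tsum_congr fun p => ?_
  rw [Complex.re_ofReal_mul, re_pow_dist hz, mul_mul_mul_comm, ← Complex.ofReal_mul,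
    Complex.re_ofReal_mul]

end PowerSums

section TaylorCoefficients

variable {a : ℂ → ℂ} {M : ℝ} {z : ℂ}

lemma re_lt_one_of_norm_lt_one (hz : ‖z‖ < 1) : z.re < 1 := (Complex.re_le_norm z).trans_lt hz

lemma norm_one_sub_le_two (hz : ‖z‖ ≤ 1) : ‖1 - z‖ ≤ 2 := by
  linarith [norm_sub_le 1 z, norm_one (α := ℂ)]

lemma norm_one_sub_sq_lt (hz : ‖z‖ < 1) : ‖1 - z‖ ^ 2 < 2 * (1 - z.re) := by
  have h_sq : ‖z‖ ^ 2 < 1 := by nlinarith [norm_nonneg z]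
  rw [← Complex.normSq_eq_norm_sq, Complex.normSq_apply] at h_sq ⊢
  simp only [Complex.sub_re, Complex.one_re, Complex.sub_im, Complex.one_im]
  nlinarith

/-- Cauchy's estimate on the disc of radius `‖1 - z‖ ^ 2 / 2` about `z`, which lies in the half
plane and on which `‖1 - w‖ ≤ 2 * ‖1 - z‖`. -/
lemma norm_iteratedDeriv_le_of_norm_le_mul_pow (n : ℕ) (ha : DifferentiableOn ℂ a {z | z.re < 1})
    (ha_norm : ∀ z : ℂ, z.re < 1 → ‖a z‖ ≤ M * ‖1 - z‖ ^ (2 * n)) (hz : ‖z‖ < 1) :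
    ‖iteratedDeriv n a z‖ ≤ n.factorial * (8 ^ n * M) := by
  have h_pos : 0 < ‖1 - z‖ := by
    rw [norm_pos_iff, sub_ne_zero]
    rintro rfl
    simp at hz
  have h_half_plane : Metric.closedBall z (‖1 - z‖ ^ 2 / 2) ⊆ {w : ℂ | w.re < 1} := fun w hw => by
    have h_re := (Complex.re_le_norm (w - z)).trans (mem_closedBall_iff_norm.mp hw)
    rw [Complex.sub_re] at h_re
    exact show w.re < 1 by linarith [norm_one_sub_sq_lt hz]
  have hM : 0 ≤ M := by simpa using (norm_nonneg _).trans (ha_norm 0 (by simp))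
  have h_sphere (w : ℂ) (hw : w ∈ Metric.sphere z (‖1 - z‖ ^ 2 / 2)) :
      ‖a w‖ ≤ M * (2 * ‖1 - z‖) ^ (2 * n) := by
    have h_dist : ‖1 - w‖ ≤ 2 * ‖1 - z‖ := by
      have h_triangle := norm_sub_le (1 - z) (w - z)
      rw [sub_sub_sub_cancel_right, mem_sphere_iff_norm.mp hw] at h_triangle
      nlinarith [norm_one_sub_le_two hz.le]
    refine (ha_norm w (h_half_plane (Metric.sphere_subset_closedBall hw))).trans ?_
    gcongr
  refine (Complex.norm_iteratedDeriv_le_of_forall_mem_sphere_norm_le n (by positivity)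
    (ha.mono (Metric.closure_ball_subset_closedBall.trans h_half_plane)).diffContOnCl
    h_sphere).trans_eq ?_
  rw [mul_pow, pow_mul 2, pow_mul ‖1 - z‖, div_pow, show (8 : ℝ) = 2 ^ 2 * 2 by norm_num,
    mul_pow (2 ^ 2)]
  field_simp

lemma norm_iteratedDeriv_zero_le_of_norm_le (n : ℕ) (ha : DifferentiableOn ℂ a (Metric.ball 0 1))
    (ha_norm : ∀ z, ‖z‖ < 1 → ‖a z‖ ≤ M) : ‖iteratedDeriv n a 0‖ ≤ n.factorial * M := by
  have h_radius : ∀ ρ ∈ Ioo (0 : ℝ) 1, ‖iteratedDeriv n a 0‖ * ρ ^ n ≤ n.factorial * M := by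
    intro ρ hρ
    rw [← le_div_iff₀ (pow_pos hρ.1 n)]
    refine Complex.norm_iteratedDeriv_le_of_forall_mem_sphere_norm_le n hρ.1
      (ha.mono ?_).diffContOnCl fun w hw => ha_norm w ?_
    · exact Metric.closure_ball_subset_closedBall.trans (Metric.closedBall_subset_ball hρ.2)
    · exact (mem_sphere_zero_iff_norm.mp hw).trans_lt hρ.2
  have h_limit : Tendsto (fun ρ : ℝ => ‖iteratedDeriv n a 0‖ * ρ ^ n) (𝓝[<] 1)
      (𝓝 (‖iteratedDeriv n a 0‖ * 1 ^ n)) :=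
    (Continuous.tendsto (by fun_prop) 1).mono_left nhdsWithin_le_nhds
  rw [one_pow, mul_one] at h_limit
  refine le_of_tendsto h_limit ?_
  filter_upwards [Ioo_mem_nhdsLT (zero_lt_one' ℝ)] with ρ hρ using h_radius ρ hρ

lemma summable_norm_taylorCoeff (ha : DifferentiableOn ℂ a (Metric.ball 0 1))
    (ha_deriv : ∀ z, ‖z‖ < 1 → ‖iteratedDeriv 2 a z‖ ≤ M) :
    Summable fun n => ‖(n.factorial : ℂ)⁻¹ * iteratedDeriv n a 0‖ := by
  have h_diff : DifferentiableOn ℂ (iteratedDeriv 2 a) (Metric.ball 0 1) := by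
    rw [iteratedDeriv_succ, iteratedDeriv_one]
    exact (ha.deriv Metric.isOpen_ball).deriv Metric.isOpen_ball
  have h_coeff (n : ℕ) : ‖((n + 2).factorial : ℂ)⁻¹ * iteratedDeriv (n + 2) a 0‖ ≤
      M * (1 / ((n + 1 : ℕ) : ℝ) ^ 2) := by
    have h_deriv := norm_iteratedDeriv_zero_le_of_norm_le n h_diff ha_deriv
    have hM : 0 ≤ M := (norm_nonneg _).trans (ha_deriv 0 (by simp))
    have h_iterate : iteratedDeriv n (iteratedDeriv 2 a) = iteratedDeriv (n + 2) a := by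
      simp only [iteratedDeriv_eq_iterate, Function.iterate_add_apply]
    rw [h_iterate] at h_deriv
    rw [norm_mul, norm_inv, Complex.norm_natCast, Nat.factorial_succ, Nat.factorial_succ]
    push_cast
    calc (((n : ℝ) + 1 + 1) * ((n + 1) * n.factorial))⁻¹ * ‖iteratedDeriv (n + 2) a 0‖
        ≤ (((n : ℝ) + 1) * ((n + 1) * n.factorial))⁻¹ * (n.factorial * M) := by
          gcongr
          linarith
      _ = M * (1 / ((n : ℝ) + 1) ^ 2) := by field_simp
  refine (summable_nat_add_iff 2).mp (Summable.of_nonneg_of_le (fun _ => norm_nonneg _) h_coeff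
    (Summable.mul_left _ ?_))
  exact (summable_nat_add_iff (f := fun n : ℕ => 1 / (n : ℝ) ^ 2) 1).mpr
    (Real.summable_one_div_nat_pow.mpr one_lt_two)

lemma exists_summable_powerSum_eq (ha : DifferentiableOn ℂ a (Metric.ball 0 1))
    (ha_deriv : ∀ z, ‖z‖ < 1 → ‖iteratedDeriv 2 a z‖ ≤ M)
    (ha_conj : ∀ z, a (conj z) = conj (a z)) :
    ∃ c : ℕ → ℝ, (Summable fun n => |c n|) ∧ ∀ z, ‖z‖ < 1 → powerSum c id z = a z := by
  set α : ℕ → ℂ := fun n => (n.factorial : ℂ)⁻¹ * iteratedDeriv n a 0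
  have hα_sum {z : ℂ} (hz : ‖z‖ < 1) : HasSum (fun n => α n * z ^ n) (a z) := by
    have h_taylor := Complex.hasSum_taylorSeries_on_ball ha (mem_ball_zero_iff.mpr hz)
    simp only [sub_zero, smul_eq_mul] at h_taylor
    exact h_taylor.congr_fun fun n => by ring
  refine ⟨fun n => (α n).re, (summable_norm_taylorCoeff ha ha_deriv).of_nonneg_of_le
    (fun _ => abs_nonneg _) fun n => Complex.abs_re_le_norm _, fun z hz => ?_⟩
  have h_conj := Complex.hasSum_conj'.mpr (hα_sum ((RCLike.norm_conj z).trans_lt hz))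
  rw [ha_conj, Complex.conj_conj] at h_conj
  have h_average := ((hα_sum hz).add h_conj).div_const 2
  rw [add_self_div_two] at h_average
  refine (h_average.congr_fun fun n => ?_).tsum_eq
  rw [Complex.re_eq_add_conj, map_mul _ (α n), map_pow, Complex.conj_conj, id]
  ring

end TaylorCoefficients

section HalfPlane

/-- The simple pole `ε / (1 + δ - z)`; for `ε, δ ≥ 0` its real part is nonnegative on the half
plane `Re z < 1`. -/
def simplePole (ε δ : ℝ) (z : ℂ) : ℂ := ε * (1 + δ - z)⁻¹

section SimplePole

variable {ε δ : ℝ} {z : ℂ}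

lemma simplePole_conj : simplePole ε δ (conj z) = conj (simplePole ε δ z) := by
  simp [simplePole, map_inv₀]

lemma re_one_add_sub : (1 + δ - z).re = 1 + δ - z.re := by simp

lemma re_simplePole_nonneg (hε : 0 ≤ ε) (hδ : 0 ≤ δ) (hz : z.re < 1) :
    0 ≤ (simplePole ε δ z).re := by
  rw [simplePole, Complex.re_ofReal_mul, Complex.inv_re, re_one_add_sub]
  exact mul_nonneg hε (div_nonneg (by linarith) (Complex.normSq_nonneg _))

lemma norm_simplePole_le (hε : 0 ≤ ε) (hδ : 0 ≤ δ) {η : ℝ} (hη : 0 < η) (hz : z.re ≤ 1 - η) :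
    ‖simplePole ε δ z‖ ≤ ε * η⁻¹ := by
  have h_re := Complex.re_le_norm (1 + δ - z)
  rw [re_one_add_sub] at h_re
  rw [simplePole, norm_mul, norm_inv, Complex.norm_real, Real.norm_of_nonneg hε]
  gcongr
  linarith

lemma differentiableAt_simplePole (hz : z.re < 1 + δ) :
    DifferentiableAt ℂ (simplePole ε δ) z := by
  have h_ne : 1 + (δ : ℂ) - z ≠ 0 := fun h => by
    have h_re := congrArg Complex.re h
    rw [re_one_add_sub, Complex.zero_re] at h_re
    linarith
  exact (DifferentiableAt.inv (by fun_prop) h_ne).const_mul _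

lemma inDiscAlgebra_exp_simplePole (hδ : 0 < δ) :
    InDiscAlgebra fun z => Complex.exp (simplePole ε δ z) := by
  refine DifferentiableOn.diffContOnCl fun z hz => ?_
  rw [closure_ball _ one_ne_zero, mem_closedBall_zero_iff] at hz
  exact (differentiableAt_simplePole
    (by linarith [Complex.re_le_norm z])).cexp.differentiableWithinAt

end SimplePole

variable {ι : Type*}

/-- The sum `∑ᵢ εᵢ / (1 + δᵢ - z)` of simple poles. -/
def poleSum (ε δ : ι → ℝ) (z : ℂ) : ℂ := ∑' i, simplePole (ε i) (δ i) z

variable {ε δ : ι → ℝ} {z : ℂ}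

lemma poleSum_conj : poleSum ε δ (conj z) = conj (poleSum ε δ z) := by
  simp only [poleSum, Complex.conj_tsum, simplePole_conj]

section

variable (hε : ∀ i, 0 ≤ ε i) (hε_sum : Summable ε) (hδ : ∀ i, 0 ≤ δ i)

include hε hε_sum hδ

lemma summable_simplePole (hz : z.re < 1) : Summable fun i => simplePole (ε i) (δ i) z :=
  Summable.of_norm_bounded (hε_sum.mul_right (1 - z.re)⁻¹) fun i =>
    norm_simplePole_le (hε i) (hδ i) (by linarith) (by linarith)

lemma re_simplePole_le_re_poleSum (i : ι) (hz : z.re < 1) :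
    (simplePole (ε i) (δ i) z).re ≤ (poleSum ε δ z).re :=
  le_hasSum (Complex.hasSum_re (summable_simplePole hε hε_sum hδ hz).hasSum) i fun k _ =>
    re_simplePole_nonneg (hε k) (hδ k) hz

lemma differentiableOn_poleSum : DifferentiableOn ℂ (poleSum ε δ) {z | z.re < 1} := by
  intro z (hz : z.re < 1)
  obtain ⟨η, hη, hzη⟩ : ∃ η > 0, z.re < 1 - η := ⟨(1 - z.re) / 2, by linarith, by linarith⟩
  have h_open : IsOpen {w : ℂ | w.re < 1 - η} := isOpen_lt Complex.continuous_re continuous_const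
  refine ((Complex.differentiableOn_tsum_of_summable_norm (hε_sum.mul_right η⁻¹)
    (fun i w (hw : w.re < 1 - η) => ?_) h_open
    fun i w (hw : w.re < 1 - η) => norm_simplePole_le (hε i) (hδ i) hη hw.le).differentiableAt
      (h_open.mem_nhds hzη)).differentiableWithinAt
  exact (differentiableAt_simplePole (by linarith [hδ i])).differentiableWithinAt

end

/-- The function `(1 - z)⁴ exp (-h) / 32` with `h = poleSum ε δ`. The fourth power makes its second
derivative bounded, and the constant makes its modulus at most `1 / 2`, on the unit disc. -/
def expNegPoleSum (ε δ : ι → ℝ) (z : ℂ) : ℂ := 32⁻¹ * (1 - z) ^ 4 * Complex.exp (-poleSum ε δ z)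

lemma expNegPoleSum_conj : expNegPoleSum ε δ (conj z) = conj (expNegPoleSum ε δ z) := by
  simp only [expNegPoleSum, poleSum_conj, map_mul, map_pow, map_sub, map_one, map_inv₀,
    ← Complex.exp_conj, map_neg, Complex.conj_ofNat]

lemma expNegPoleSum_ne_zero (hz : z ≠ 1) : expNegPoleSum ε δ z ≠ 0 :=
  mul_ne_zero (mul_ne_zero (by norm_num) (pow_ne_zero _ (sub_ne_zero.mpr hz.symm)))
    (Complex.exp_ne_zero _)

lemma norm_expNegPoleSum_mul_exp_le {u : ℂ} (hu : u.re ≤ (poleSum ε δ z).re) :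
    ‖expNegPoleSum ε δ z * Complex.exp u‖ ≤ 32⁻¹ * ‖1 - z‖ ^ 4 := by
  rw [expNegPoleSum, mul_assoc, ← Complex.exp_add, norm_mul, norm_mul, norm_inv, norm_pow,
    Complex.norm_ofNat, Complex.norm_exp]
  refine mul_le_of_le_one_right (by positivity) (Real.exp_le_one_iff.mpr ?_)
  rw [Complex.add_re, Complex.neg_re]
  linarith

lemma norm_pow_four_div_le (hz : ‖z‖ < 1) : 32⁻¹ * ‖1 - z‖ ^ 4 ≤ 2⁻¹ :=
  calc 32⁻¹ * ‖1 - z‖ ^ 4 ≤ 32⁻¹ * 2 ^ 4 := by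
        gcongr
        exact norm_one_sub_le_two hz.le
    _ = 2⁻¹ := by norm_num

lemma InDiscAlgebra.norm_le_of_forall_norm_lt_one {F : ℂ → ℂ} {M : ℝ} (hF : InDiscAlgebra F)
    (h : ∀ z, ‖z‖ < 1 → ‖F z‖ ≤ M) (hz : ‖z‖ ≤ 1) : ‖F z‖ ≤ M :=
  le_on_closure (fun w hw => h w (mem_ball_zero_iff.mp hw)) hF.2.norm continuousOn_const
    (by simpa [closure_ball] using hz)

lemma exists_powerSum_ne_zero_norm_mul_exp_le (hε : ∀ i, 0 ≤ ε i) (hε_sum : Summable ε)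
    (hδ : ∀ i, 0 < δ i) :
    ∃ c : ℕ → ℝ, (Summable fun n => |c n|) ∧ (∀ z, ‖z‖ < 1 → powerSum c id z ≠ 0) ∧
      (∀ z, ‖z‖ ≤ 1 → ‖powerSum c id z‖ ≤ 2⁻¹) ∧ ∀ i z, ‖z‖ ≤ 1 →
        ‖powerSum c id z * Complex.exp (simplePole (ε i) (δ i) z)‖ ≤ 2⁻¹ := by
  have hδ_nonneg (i : ι) : 0 ≤ δ i := (hδ i).le
  have h_re_nonneg {z : ℂ} (hz : z.re < 1) : 0 ≤ (poleSum ε δ z).re :=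
    HasSum.nonneg (fun i => re_simplePole_nonneg (hε i) (hδ_nonneg i) hz)
      (Complex.hasSum_re (summable_simplePole hε hε_sum hδ_nonneg hz).hasSum)
  have h_diff : DifferentiableOn ℂ (expNegPoleSum ε δ) {z | z.re < 1} :=
    DifferentiableOn.mul (by fun_prop) (differentiableOn_poleSum hε hε_sum hδ_nonneg).neg.cexp
  have h_norm {z : ℂ} (hz : z.re < 1) : ‖expNegPoleSum ε δ z‖ ≤ 32⁻¹ * ‖1 - z‖ ^ 4 := by
    simpa using norm_expNegPoleSum_mul_exp_le (u := 0) (h_re_nonneg hz)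
  obtain ⟨c, hc, hcA⟩ := exists_summable_powerSum_eq
    (h_diff.mono fun z hz => re_lt_one_of_norm_lt_one (mem_ball_zero_iff.mp hz))
    (fun z => norm_iteratedDeriv_le_of_norm_le_mul_pow 2 h_diff fun w => h_norm)
    fun z => expNegPoleSum_conj
  have hA := inDiscAlgebra_powerSum id hc
  refine ⟨c, hc, fun z hz => ?_, fun z => hA.norm_le_of_forall_norm_lt_one fun w hw => ?_,
    fun i z => (hA.mul (inDiscAlgebra_exp_simplePole (hδ i))).norm_le_of_forall_norm_lt_one
      fun w hw => ?_⟩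
  · rw [hcA z hz]
    refine expNegPoleSum_ne_zero ?_
    rintro rfl
    simp at hz
  · rw [hcA w hw]
    exact (h_norm (re_lt_one_of_norm_lt_one hw)).trans (norm_pow_four_div_le hw)
  · rw [hcA w hw]
    exact (norm_expNegPoleSum_mul_exp_le (re_simplePole_le_re_poleSum hε hε_sum hδ_nonneg i
      (re_lt_one_of_norm_lt_one hw))).trans (norm_pow_four_div_le hw)

end HalfPlane

section Blaschke

/-- The Blaschke factor of the unit disc with the real zero `w`. -/
def blaschkeFactor (w : ℝ) (z : ℂ) : ℂ := (w - z) * (1 - w * z)⁻¹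

lemma blaschkeFactor_conj (w : ℝ) (z : ℂ) :
    blaschkeFactor w (conj z) = conj (blaschkeFactor w z) := by
  simp [blaschkeFactor, map_inv₀]

section Factor

variable {w : ℝ} (hw_nonneg : 0 ≤ w) (hw_lt_one : w < 1) {z : ℂ}

lemma norm_one_sub_mul_sq (w : ℝ) (z : ℂ) :
    ‖1 - w * z‖ ^ 2 = ‖w - z‖ ^ 2 + (1 - w ^ 2) * (1 - ‖z‖ ^ 2) := by
  simp only [← Complex.normSq_eq_norm_sq, Complex.normSq_apply, Complex.sub_re, Complex.sub_im,
    Complex.one_re, Complex.one_im, Complex.re_ofReal_mul, Complex.im_ofReal_mul,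
    Complex.ofReal_re, Complex.ofReal_im]
  ring

include hw_nonneg

lemma one_sub_le_norm_one_sub_mul (hz : ‖z‖ ≤ 1) : 1 - w ≤ ‖1 - w * z‖ := by
  have h_triangle := norm_sub_norm_le (1 : ℂ) (w * z)
  rw [norm_one, norm_mul, Complex.norm_real, Real.norm_of_nonneg hw_nonneg] at h_triangle
  linarith [mul_le_of_le_one_right hw_nonneg hz]

include hw_lt_one

lemma norm_one_sub_mul_pos (hz : ‖z‖ ≤ 1) : 0 < ‖1 - w * z‖ :=
  (sub_pos.mpr hw_lt_one).trans_le (one_sub_le_norm_one_sub_mul hw_nonneg hz)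

lemma norm_blaschkeFactor_le_one (hz : ‖z‖ ≤ 1) : ‖blaschkeFactor w z‖ ≤ 1 := by
  rw [blaschkeFactor, norm_mul, norm_inv, ← div_eq_mul_inv,
    div_le_one (norm_one_sub_mul_pos hw_nonneg hw_lt_one hz), ← sq_le_sq₀ (norm_nonneg _)
    (norm_nonneg _), norm_one_sub_mul_sq]
  exact le_add_of_nonneg_right (mul_nonneg (by nlinarith) (by nlinarith [norm_nonneg z]))

lemma norm_blaschkeFactor_eq_one (hz : ‖z‖ = 1) : ‖blaschkeFactor w z‖ = 1 := by
  rw [blaschkeFactor, norm_mul, norm_inv, ← div_eq_mul_inv,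
    div_eq_one_iff_eq (norm_one_sub_mul_pos hw_nonneg hw_lt_one hz.le).ne',
    ← sq_eq_sq₀ (norm_nonneg _) (norm_nonneg _), norm_one_sub_mul_sq, hz]
  ring

lemma inDiscAlgebra_blaschkeFactor : InDiscAlgebra (blaschkeFactor w) := by
  refine DifferentiableOn.diffContOnCl fun z hz => DifferentiableAt.differentiableWithinAt ?_
  rw [closure_ball _ one_ne_zero, mem_closedBall_zero_iff] at hz
  have h_ne := norm_pos_iff.mp (norm_one_sub_mul_pos hw_nonneg hw_lt_one hz)
  exact DifferentiableAt.mul (by fun_prop) (DifferentiableAt.inv (by fun_prop) h_ne)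

lemma norm_blaschkeFactor_sub_one_le (hz : ‖z‖ ≤ 1) (hz_ne : z ≠ 1) :
    ‖blaschkeFactor w z - 1‖ ≤ (1 - w) * (4 / ‖1 - z‖) := by
  have h_pos := norm_one_sub_mul_pos hw_nonneg hw_lt_one hz
  have h_sub_one : blaschkeFactor w z - 1 = -((1 - w : ℝ) : ℂ) * (1 + z) * (1 - w * z)⁻¹ := by
    have h_ne := norm_pos_iff.mp h_pos
    rw [blaschkeFactor]
    push_cast
    field_simp
    ring
  have h_norm : ‖((1 - w : ℝ) : ℂ)‖ = 1 - w := by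
    rw [Complex.norm_real, Real.norm_of_nonneg (sub_nonneg.mpr hw_lt_one.le)]
  have h_denominator : ‖1 - z‖ ≤ 2 * ‖1 - w * z‖ :=
    calc ‖1 - z‖ = ‖(1 - w * z) - ((1 - w : ℝ) : ℂ) * z‖ := by push_cast; ring_nf
      _ ≤ ‖1 - w * z‖ + (1 - w) * ‖z‖ :=
        (norm_sub_le _ _).trans_eq (by rw [norm_mul, h_norm])
      _ ≤ 2 * ‖1 - w * z‖ := by
        nlinarith [one_sub_le_norm_one_sub_mul hw_nonneg hz]
  have h_numerator : ‖1 + z‖ ≤ 2 :=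
    (norm_add_le 1 z).trans (by rw [norm_one]; linarith)
  rw [h_sub_one, norm_mul, norm_mul, norm_neg, norm_inv, h_norm, mul_assoc, ← div_eq_mul_inv]
  refine mul_le_mul_of_nonneg_left ?_ (sub_nonneg.mpr hw_lt_one.le)
  rw [div_le_div_iff₀ h_pos (norm_pos_iff.mpr (sub_ne_zero.mpr hz_ne.symm))]
  nlinarith [norm_nonneg (1 - z)]

end Factor

/-- The Blaschke product with the real zeros `w n`, meaningful when `∑ (1 - w n) < ∞`. -/
def blaschke (w : ℕ → ℝ) (z : ℂ) : ℂ := ∏' n, blaschkeFactor (w n) z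

lemma blaschke_apply_zero (w : ℕ → ℝ) (n : ℕ) : blaschke w (w n) = 0 :=
  tprod_of_exists_eq_zero ⟨n, by simp [blaschkeFactor]⟩

section Product

variable {w : ℕ → ℝ} (hw_nonneg : ∀ n, 0 ≤ w n) (hw_lt_one : ∀ n, w n < 1)
  (hw_sum : Summable fun n => 1 - w n) {z : ℂ}

include hw_nonneg hw_lt_one hw_sum

lemma hasProd_blaschke (hz : ‖z‖ ≤ 1) (hz_ne : z ≠ 1) :
    HasProd (fun n => blaschkeFactor (w n) z) (blaschke w z) := by
  have h_summable : Summable fun n => ‖blaschkeFactor (w n) z - 1‖ :=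
    Summable.of_nonneg_of_le (fun _ => norm_nonneg _)
      (fun n => norm_blaschkeFactor_sub_one_le (hw_nonneg n) (hw_lt_one n) hz hz_ne)
      (hw_sum.mul_right _)
  simpa only [add_sub_cancel, blaschke] using (multipliable_one_add_of_summable h_summable).hasProd

lemma norm_blaschke_eq_one (hz : ‖z‖ = 1) (hz_ne : z ≠ 1) : ‖blaschke w z‖ = 1 := by
  have h_prod := (hasProd_blaschke hw_nonneg hw_lt_one hw_sum hz.le hz_ne).norm
  simp only [norm_blaschkeFactor_eq_one (hw_nonneg _) (hw_lt_one _) hz] at h_prod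
  exact h_prod.unique hasProd_one

lemma blaschke_conj (hz : ‖z‖ ≤ 1) (hz_ne : z ≠ 1) :
    blaschke w (conj z) = conj (blaschke w z) := by
  have h_prod := (hasProd_blaschke hw_nonneg hw_lt_one hw_sum hz hz_ne).map (starRingEnd ℂ)
    Complex.continuous_conj
  simp only [Function.comp_def, ← blaschkeFactor_conj] at h_prod
  exact h_prod.tprod_eq

lemma isHInf_blaschke : IsHInf (blaschke w) := by
  have h_tendsto (z : ℂ) (hz : ‖z‖ ≤ 1) (hz_ne : z ≠ 1) :=
    (hasProd_blaschke hw_nonneg hw_lt_one hw_sum hz hz_ne).tendsto_prod_nat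
  refine ⟨1, fun N z => ∏ n ∈ Finset.range N, blaschkeFactor (w n) z, fun N => ?_,
    fun N z hz => ?_, fun z hz => h_tendsto z hz.le ?_, ?_⟩
  · have h_factor (n : ℕ) := inDiscAlgebra_blaschkeFactor (hw_nonneg n) (hw_lt_one n)
    exact ⟨DifferentiableOn.fun_finsetProd fun n _ => (h_factor n).1,
      continuousOn_finsetProd _ fun n _ => (h_factor n).2⟩
  · rw [norm_prod]
    exact Finset.prod_le_one (fun _ _ => norm_nonneg _)
      fun n _ => norm_blaschkeFactor_le_one (hw_nonneg n) (hw_lt_one n) hz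
  · rintro rfl
    simp at hz
  · filter_upwards [ae_circlePoint_ne 1] with t ht using h_tendsto _ (norm_circlePoint t).le ht

lemma exp_neg_tsum_le_norm_blaschke {t : ℕ → ℝ} (ht : Summable t) (hz : ‖z‖ ≤ 1) (hz_ne : z ≠ 1)
    (h : ∀ n, Real.exp (-t n) ≤ ‖blaschkeFactor (w n) z‖) :
    Real.exp (-∑' n, t n) ≤ ‖blaschke w z‖ :=
  le_of_tendsto_of_tendsto' ht.hasSum.neg.rexp.tendsto_prod_nat
    (hasProd_blaschke hw_nonneg hw_lt_one hw_sum hz hz_ne).norm.tendsto_prod_nat fun _ =>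
      Finset.prod_le_prod (fun _ _ => (Real.exp_pos _).le) fun n _ => h n

end Product

end Blaschke

section Lacunary

/-- The Blaschke zeros `1 - 8⁻ⁿ`. -/
def lacunaryZero (n : ℕ) : ℝ := 1 - 8⁻¹ ^ n

lemma lacunaryZero_nonneg (n : ℕ) : 0 ≤ lacunaryZero n :=
  sub_nonneg.mpr (pow_le_one₀ (by norm_num) (by norm_num))

lemma lacunaryZero_lt_one (n : ℕ) : lacunaryZero n < 1 :=
  sub_lt_self _ (by positivity)

lemma norm_lacunaryZero_lt_one (n : ℕ) : ‖(lacunaryZero n : ℂ)‖ < 1 := by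
  rw [Complex.norm_real, Real.norm_of_nonneg (lacunaryZero_nonneg n)]
  exact lacunaryZero_lt_one n

lemma one_sub_lacunaryZero (n : ℕ) : 1 - lacunaryZero n = 8⁻¹ ^ n :=
  sub_sub_cancel _ _

lemma summable_inv_eight_pow : Summable fun n : ℕ => (8⁻¹ : ℝ) ^ n :=
  summable_geometric_of_lt_one (by norm_num) (by norm_num)

lemma summable_one_sub_lacunaryZero : Summable fun n => 1 - lacunaryZero n := by
  simpa only [one_sub_lacunaryZero] using summable_inv_eight_pow

lemma exp_neg_le_div {t : ℝ} (ht_nonneg : 0 ≤ t) (ht : t ≤ 24 / 25) :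
    Real.exp (-(50 * t)) ≤ (1 - t) / (1 + t) := by
  have h_pos : 0 < 1 - t := by linarith
  rw [Real.exp_neg, inv_le_comm₀ (Real.exp_pos _) (by positivity), inv_div, div_le_iff₀ h_pos]
  nlinarith [Real.add_one_le_exp (50 * t)]

lemma div_le_abs_sub_div_add {d e t : ℝ} (hd : 0 < d) (he : 0 < e) (ht : 0 ≤ t)
    (h : d ≤ t * e) : (1 - t) / (1 + t) ≤ |d - e| / (d + e) := by
  rw [div_le_div_iff₀ (by positivity) (by positivity), abs_sub_comm]
  nlinarith [le_abs_self (e - d)]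

lemma abs_sub_div_add_le_norm_blaschkeFactor {d e : ℝ} (hd : 0 < d) (he : 0 < e) (he_le : e ≤ 1) :
    |d - e| / (d + e) ≤ ‖blaschkeFactor (1 - e) (1 - d : ℝ)‖ := by
  have h_value : blaschkeFactor (1 - e) (1 - d : ℝ) = ((d - e) / (d + e - e * d) : ℝ) := by
    rw [blaschkeFactor, div_eq_mul_inv]
    push_cast
    ring_nf
  have h_pos : 0 < d + e - e * d := by nlinarith
  rw [h_value, Complex.norm_real, Real.norm_eq_abs, abs_div, abs_of_pos h_pos]
  gcongr
  exact sub_le_self _ (by positivity)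

lemma exp_neg_le_norm_blaschkeFactor {d e t : ℝ} (hd : 0 < d) (he : 0 < e) (he_le : e ≤ 1)
    (ht_nonneg : 0 ≤ t) (ht : t ≤ 24 / 25) (h : d ≤ t * e ∨ e ≤ t * d) :
    Real.exp (-(50 * t)) ≤ ‖blaschkeFactor (1 - e) (1 - d : ℝ)‖ := by
  refine (exp_neg_le_div ht_nonneg ht).trans <|
    le_trans ?_ (abs_sub_div_add_le_norm_blaschkeFactor hd he he_le)
  rcases h with h | h
  · exact div_le_abs_sub_div_add hd he ht_nonneg h
  · rw [abs_sub_comm, add_comm d]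
    exact div_le_abs_sub_div_add he hd ht_nonneg h

/-- `1 - d` lies between the neighbours of the zero number `n` and is bounded away, in the
pseudohyperbolic distance, from the zeros; its distance to the zero number `m` tends to `1`
geometrically in `|m - n|`. -/
lemma exp_neg_le_norm_blaschkeFactor_lacunaryZero {n : ℕ} {d : ℝ}
    (h_lower : 2 / 15 * 8⁻¹ ^ n ≤ d) (h_upper : d ≤ 15 / 2 * 8⁻¹ ^ n)
    (h_gap : d ≤ 24 / 25 * 8⁻¹ ^ n ∨ 8⁻¹ ^ n ≤ 24 / 25 * d) (m : ℕ) :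
    Real.exp (-(375 * 8⁻¹ ^ (m - n : ℤ).natAbs)) ≤
      ‖blaschkeFactor (lacunaryZero m) (1 - d : ℝ)‖ := by
  have hn : (0 : ℝ) < 8⁻¹ ^ n := by positivity
  have hd : 0 < d := lt_of_lt_of_le (by positivity) h_lower
  have h_le_one : (8⁻¹ : ℝ) ^ m ≤ 1 := pow_le_one₀ (by norm_num) (by norm_num)
  have h_factor {t x : ℝ} (ht_nonneg : 0 ≤ t) (ht : t ≤ 24 / 25) (htx : 50 * t ≤ x)
      (h : d ≤ t * 8⁻¹ ^ m ∨ 8⁻¹ ^ m ≤ t * d) :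
      Real.exp (-x) ≤ ‖blaschkeFactor (lacunaryZero m) (1 - d : ℝ)‖ :=
    (Real.exp_le_exp.mpr (neg_le_neg htx)).trans
      (exp_neg_le_norm_blaschkeFactor hd (by positivity) h_le_one ht_nonneg ht h)
  have h_decay {k : ℕ} (hk : k ≠ 0) : (8⁻¹ : ℝ) ^ k ≤ 8⁻¹ :=
    pow_le_of_le_one (by norm_num) (by norm_num) hk
  rcases lt_trichotomy m n with h | rfl | h
  · obtain ⟨k, rfl⟩ := Nat.exists_eq_add_of_le h.le
    have hk := h_decay (k := k) (by lia)
    rw [show ((m : ℤ) - (m + k : ℕ)).natAbs = k by lia]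
    rw [pow_add] at h_upper
    exact h_factor (t := 15 / 2 * 8⁻¹ ^ k) (by positivity) (by linarith) (by linarith)
      (.inl (by linarith))
  · exact h_factor (by norm_num) le_rfl (by norm_num) h_gap
  · obtain ⟨k, rfl⟩ := Nat.exists_eq_add_of_le h.le
    have hk := h_decay (k := k) (by lia)
    rw [show (((n + k : ℕ) : ℤ) - n).natAbs = k by lia]
    refine h_factor (t := 15 / 2 * 8⁻¹ ^ k) (by positivity) (by linarith) (by linarith) (.inr ?_)
    rw [pow_add]
    nlinarith [mul_le_mul_of_nonneg_right h_lower (show (0 : ℝ) ≤ 8⁻¹ ^ k by positivity)]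

lemma summable_inv_eight_pow_natAbs : Summable fun k : ℤ => (8⁻¹ : ℝ) ^ k.natAbs :=
  summable_int_iff_summable_nat_and_neg.mpr (by simpa using summable_inv_eight_pow)

lemma exp_neg_tsum_le_norm_blaschke_lacunaryZero {n : ℕ} {d : ℝ} (hd : d < 1)
    (h_lower : 2 / 15 * 8⁻¹ ^ n ≤ d) (h_upper : d ≤ 15 / 2 * 8⁻¹ ^ n)
    (h_gap : d ≤ 24 / 25 * 8⁻¹ ^ n ∨ 8⁻¹ ^ n ≤ 24 / 25 * d) :
    Real.exp (-∑' k : ℤ, 375 * 8⁻¹ ^ k.natAbs) ≤ ‖blaschke lacunaryZero (1 - d : ℝ)‖ := by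
  have hd_pos : 0 < d := lt_of_lt_of_le (by positivity) h_lower
  have h_summable := summable_inv_eight_pow_natAbs.mul_left 375
  have h_inj : Function.Injective fun m : ℕ => (m - n : ℤ) := fun _ _ _ => by simp_all
  refine le_trans (Real.exp_le_exp.mpr <| neg_le_neg <| tsum_comp_le_tsum_of_inj h_summable
    (fun _ => by positivity) h_inj) ?_
  refine exp_neg_tsum_le_norm_blaschke lacunaryZero_nonneg lacunaryZero_lt_one
    summable_one_sub_lacunaryZero (h_summable.comp_injective h_inj) ?_ ?_
    (exp_neg_le_norm_blaschkeFactor_lacunaryZero h_lower h_upper h_gap)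
  · rw [Complex.norm_real, Real.norm_of_nonneg (by linarith)]
    linarith
  · rw [← Complex.ofReal_one, Complex.ofReal_inj.ne]
    linarith

/-- Shrinking the zero number `j` by the factor `1 - s` moves it to distance about `s + 8⁻ʲ`
from `1`; of two consecutive values of `j`, one keeps this away from the other zeros. -/
lemma exists_le_norm_blaschke_lacunaryZero : ∃ κ > 0, ∀ s, 0 < s → s ≤ 8⁻¹ →
    ∃ j, s / 64 ≤ 8⁻¹ ^ j ∧ 8⁻¹ ^ j ≤ s ∧
      κ ≤ ‖blaschke lacunaryZero ((1 - s) * lacunaryZero j : ℝ)‖ := by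
  refine ⟨_, Real.exp_pos (-∑' k : ℤ, 375 * 8⁻¹ ^ k.natAbs), fun s hs hs_le => ?_⟩
  obtain ⟨n, hn_lt, hn_le⟩ := exists_nat_pow_near_of_lt_one hs (by linarith : s ≤ 1)
    (by norm_num : (0 : ℝ) < 8⁻¹) (by norm_num)
  have h_product (j : ℕ) : (1 - s) * lacunaryZero j = 1 - (s + (1 - s) * 8⁻¹ ^ j) := by
    rw [lacunaryZero]; ring
  have h_bounds (j : ℕ) : 7 / 8 * 8⁻¹ ^ j ≤ (1 - s) * (8⁻¹ : ℝ) ^ j ∧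
      (1 - s) * (8⁻¹ : ℝ) ^ j ≤ 8⁻¹ ^ j := by
    have h_pos : (0 : ℝ) < 8⁻¹ ^ j := by positivity
    constructor <;> nlinarith
  rcases le_total s (15 / 16 * 8⁻¹ ^ n) with h | h
  · have h_pow : (8⁻¹ : ℝ) ^ (n + 2) = 8⁻¹ ^ n / 64 := by rw [pow_add]; norm_num; ring
    obtain ⟨h_ge, h_le⟩ := h_bounds (n + 2)
    have h_le_one : (8⁻¹ : ℝ) ^ n ≤ 1 := pow_le_one₀ (by norm_num) (by norm_num)
    rw [pow_succ] at hn_lt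
    refine ⟨n + 2, by linarith, by linarith, ?_⟩
    rw [h_product]
    exact exp_neg_tsum_le_norm_blaschke_lacunaryZero (n := n) (by linarith) (by linarith)
      (by linarith) (.inl (by linarith))
  · have h_pow : (8⁻¹ : ℝ) ^ (n + 1) = 8⁻¹ ^ n / 8 := by rw [pow_succ]; ring
    obtain ⟨h_ge, h_le⟩ := h_bounds (n + 1)
    refine ⟨n + 1, by linarith, by linarith, ?_⟩
    rw [h_product]
    exact exp_neg_tsum_le_norm_blaschke_lacunaryZero (n := n) (by linarith) (by linarith)
      (by linarith) (.inr (by linarith))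

end Lacunary

section Growth

lemma exists_forall_eventually_exists_le {p : ℕ → ℝ → Prop}
    (hp : ∀ n, ∀ᶠ s in 𝓝[>] 0, p n s) :
    ∃ δ : ℕ → ℝ, (∀ n, 0 < δ n) ∧ ∀ᶠ s in 𝓝[>] 0, ∃ n, δ n ≤ s ∧ p n s := by
  choose ρ hρ_pos hρ using fun n => mem_nhdsGT_iff_exists_Ioo_subset.mp (hp n)
  set τ : ℕ → ℝ := fun n => min (ρ n) (1 / (n + 1))
  have hτ_pos (n : ℕ) : 0 < τ n := lt_min (hρ_pos n) (by positivity)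
  refine ⟨fun n => τ (n + 1), fun n => hτ_pos _, ?_⟩
  filter_upwards [Ioo_mem_nhdsGT (hτ_pos 0)] with s ⟨hs_pos, hs_lt⟩
  have h_exists : ∃ n, τ n ≤ s := by
    obtain ⟨n, hn⟩ := exists_nat_one_div_lt hs_pos
    exact ⟨n, (min_le_right _ _).trans hn.le⟩
  classical
  obtain ⟨n, hn⟩ : ∃ n, Nat.find h_exists = n + 1 := Nat.exists_eq_succ_of_ne_zero fun h_zero =>
    hs_lt.not_ge (h_zero ▸ Nat.find_spec h_exists)
  have h_lt : s < τ n := not_le.mp (Nat.find_min h_exists (by lia))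
  exact ⟨n, hn ▸ Nat.find_spec h_exists, hρ n ⟨hs_pos, h_lt.trans_le (min_le_left _ _)⟩⟩

lemma tendsto_one_sub_nhdsLT_one : Tendsto (fun r : ℝ => 1 - r) (𝓝[<] 1) (𝓝[>] 0) := by
  refine tendsto_nhdsWithin_iff.mpr ⟨?_, ?_⟩
  · exact (Continuous.tendsto' (by fun_prop) _ _ (sub_self 1)).mono_left nhdsWithin_le_nhds
  · filter_upwards [self_mem_nhdsWithin] with r hr using sub_pos.mpr (mem_Iio.mp hr)

lemma tendsto_one_sub_nhdsGT_zero : Tendsto (fun s : ℝ => 1 - s) (𝓝[>] 0) (𝓝[<] 1) := by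
  refine tendsto_nhdsWithin_iff.mpr ⟨?_, ?_⟩
  · exact (Continuous.tendsto' (by fun_prop) _ _ (sub_zero 1)).mono_left nhdsWithin_le_nhds
  · filter_upwards [self_mem_nhdsWithin] with s hs using sub_lt_self 1 (mem_Ioi.mp hs)

variable {γ : ℝ → ℝ} (hγ : (fun r => Real.log (γ r)) =o[𝓝[<] 1] fun r => (1 - r)⁻¹)

include hγ

lemma eventually_le_one_sub_pow_mul_exp (k : ℕ) {ε : ℝ} (hε : 0 < ε) :
    ∀ᶠ r in 𝓝[<] 1, γ r ≤ (1 - r) ^ k * Real.exp (ε / (1 - r)) := by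
  have h_log : Tendsto (fun r : ℝ => (1 - r) * Real.log (1 - r)) (𝓝[<] 1) (𝓝 0) :=
    (Real.continuous_mul_log.tendsto' 0 0 (zero_mul _)).comp
      (tendsto_nhds_of_tendsto_nhdsWithin tendsto_one_sub_nhdsLT_one)
  have h_limit := hγ.tendsto_div_nhds_zero.sub (h_log.const_mul (k : ℝ))
  rw [mul_zero, sub_zero] at h_limit
  filter_upwards [h_limit.eventually_lt_const hε, self_mem_nhdsWithin] with r h_lt hr
  have h_pos : 0 < 1 - r := sub_pos.mpr hr
  rw [div_inv_eq_mul, mul_left_comm, mul_comm (1 - r), ← sub_mul, ← lt_div_iff₀ h_pos] at h_lt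
  calc γ r ≤ Real.exp (Real.log (γ r)) := Real.le_exp_log _
    _ ≤ Real.exp (k * Real.log (1 - r) + ε / (1 - r)) := by
      gcongr
      linarith
    _ = (1 - r) ^ k * Real.exp (ε / (1 - r)) := by
      rw [Real.exp_add, Real.exp_nat_mul, Real.exp_log h_pos]

lemma exists_eventually_exists_le_one_sub_pow_mul_exp (k : ℕ) {ε : ℕ → ℝ} (hε : ∀ n, 0 < ε n) :
    ∃ δ : ℕ → ℝ, (∀ n, 0 < δ n) ∧ ∀ᶠ r in 𝓝[<] 1, ∃ n, δ n ≤ 1 - r ∧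
      γ r ≤ (1 - r) ^ k * Real.exp (ε n / (1 - r)) := by
  obtain ⟨δ, hδ_pos, hδ⟩ := exists_forall_eventually_exists_le fun n =>
    tendsto_one_sub_nhdsGT_zero.eventually (eventually_le_one_sub_pow_mul_exp hγ k (hε n))
  exact ⟨δ, hδ_pos, by simpa only [sub_sub_cancel] using tendsto_one_sub_nhdsLT_one.eventually hδ⟩

end Growth

section ExpNegSq

variable {u : ℝ}

lemma exp_neg_le_one_sub_half (h_nonneg : 0 ≤ u) (h_le : u ≤ 1) : Real.exp (-u) ≤ 1 - u / 2 := by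
  rw [Real.exp_neg, inv_le_iff_one_le_mul₀ (Real.exp_pos _)]
  nlinarith [Real.add_one_le_exp u]

lemma exp_neg_sq_sq (u : ℝ) : Real.exp (-u ^ 2) ^ 2 = Real.exp (-(2 * u ^ 2)) := by
  rw [← Real.exp_nat_mul]
  push_cast
  ring_nf

lemma sq_add_exp_neg_sq_sq_le_one (h_nonneg : 0 ≤ u) (h_le : u ≤ 2⁻¹) :
    u ^ 2 + Real.exp (-u ^ 2) ^ 2 ≤ 1 := by
  have h_exp := exp_neg_le_one_sub_half (u := 2 * u ^ 2) (by positivity) (by nlinarith)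
  rw [exp_neg_sq_sq]
  linarith

lemma one_sub_exp_neg_sq_sq_le (u : ℝ) : 1 - Real.exp (-u ^ 2) ^ 2 ≤ 2 * u ^ 2 := by
  rw [exp_neg_sq_sq]
  linarith [Real.add_one_le_exp (-(2 * u ^ 2))]

end ExpNegSq

section ExpNegNormSq

variable {F A : ℂ → ℂ} (hF : IsHInf F)
  (hFA : ∀ᵐ t ∂σ, ‖F (circlePoint t)‖ = Real.exp (-‖A (circlePoint t)‖ ^ 2))

include hFA

lemma norm_sq_add_norm_boundary_sq_le_one (hA_le : ∀ z, ‖z‖ ≤ 1 → ‖A z‖ ≤ 2⁻¹) :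
    ∀ᵐ t ∂σ, ‖A (circlePoint t)‖ ^ 2 + ‖(hF.boundary ∞ : LpT ∞) t‖ ^ 2 ≤ 1 := by
  filter_upwards [hFA, hF.coeFn_boundary ∞] with t ht h_eq
  rw [h_eq, ht]
  exact sq_add_exp_neg_sq_sq_le_one (norm_nonneg _) (hA_le _ (norm_circlePoint t).le)

lemma nonExtreme_boundary (hA : InDiscAlgebra A) (hA_zero : A 0 ≠ 0)
    (hA_le : ∀ z, ‖z‖ ≤ 1 → ‖A z‖ ≤ 2⁻¹) : NonExtreme (hF.boundary ∞) := by
  have h_perturbation : IsHInf fun z => A z * (2⁻¹ * A z) :=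
    (hA.mul (InDiscAlgebra.mul diffContOnCl_const hA)).isHInf
  refine nonExtreme_of_norm_add_le (h_perturbation.boundary_ne_zero ∞ (by simp [hA_zero])) ?_
  filter_upwards [hFA, hF.coeFn_boundary ∞, h_perturbation.coeFn_boundary ∞] with t ht hF_eq hA_eq
  have hA_sq_le : ‖A (circlePoint t)‖ ^ 2 ≤ 1 :=
    pow_le_one₀ (norm_nonneg _) ((hA_le _ (norm_circlePoint t).le).trans (by norm_num))
  rw [hF_eq, hA_eq, ht, norm_mul, norm_mul, norm_inv, Complex.norm_ofNat]
  linarith [exp_neg_le_one_sub_half (sq_nonneg _) hA_sq_le]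

lemma one_sub_norm_sq_mul_norm_sq_le_one {Y : ℂ → ℂ} (hAY : ∀ z, ‖z‖ ≤ 1 → ‖A z * Y z‖ ≤ 2⁻¹) :
    ∀ᵐ t ∂σ, (1 - ‖F (circlePoint t)‖ ^ 2) * ‖Y (circlePoint t)‖ ^ 2 ≤ 1 := by
  filter_upwards [hFA] with t ht
  calc (1 - ‖F (circlePoint t)‖ ^ 2) * ‖Y (circlePoint t)‖ ^ 2
      ≤ 2 * ‖A (circlePoint t)‖ ^ 2 * ‖Y (circlePoint t)‖ ^ 2 := by
        rw [ht]
        gcongr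
        exact one_sub_exp_neg_sq_sq_le _
    _ = 2 * ‖A (circlePoint t) * Y (circlePoint t)‖ ^ 2 := by rw [norm_mul]; ring
    _ ≤ 2 * 2⁻¹ ^ 2 := by
        gcongr
        exact hAY _ (norm_circlePoint t).le
    _ ≤ 1 := by norm_num

end ExpNegNormSq

section Symbol

/-- The function `B² exp (-q)`, where `B` is the Blaschke product with zeros `wₙ` and `Re q = |A|²`
on the circle for `A = ∑ₙ cₙ zⁿ`. The square makes it nonnegative on the real diameter. -/
def symbol (w c : ℕ → ℝ) (z : ℂ) : ℂ := blaschke w z ^ 2 * Complex.exp (-normSqSeries c id z)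

open scoped ComplexOrder in
lemma exp_nonneg_of_conj_eq {a : ℂ} (ha : conj a = a) : 0 ≤ Complex.exp a := by
  obtain ⟨x, rfl⟩ := Complex.conj_eq_iff_real.mp ha
  rw [← Complex.ofReal_exp]
  exact Complex.zero_le_real.mpr (Real.exp_pos x).le

open scoped ComplexOrder in
lemma sq_nonneg_of_conj_eq {a : ℂ} (ha : conj a = a) : 0 ≤ a ^ 2 := by
  obtain ⟨x, rfl⟩ := Complex.conj_eq_iff_real.mp ha
  rw [← Complex.ofReal_pow]
  exact Complex.zero_le_real.mpr (sq_nonneg x)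

variable {w c : ℕ → ℝ} {z : ℂ}

lemma symbol_apply_zero (n : ℕ) : symbol w c (w n) = 0 := by
  rw [symbol, blaschke_apply_zero, zero_pow two_ne_zero, zero_mul]

variable (hw_nonneg : ∀ n, 0 ≤ w n) (hw_lt_one : ∀ n, w n < 1)
  (hw_sum : Summable fun n => 1 - w n)
include hw_nonneg hw_lt_one hw_sum

lemma isHInf_symbol (hc : Summable fun n => |c n|) : IsHInf (symbol w c) := by
  have hB := isHInf_blaschke hw_nonneg hw_lt_one hw_sum
  have h_exp : InDiscAlgebra fun z => Complex.exp (-normSqSeries c id z) :=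
    Complex.differentiable_exp.comp_diffContOnCl
      (inDiscAlgebra_powerSum _ (summable_abs_mul_abs hc)).neg
  have h_mul := (hB.mul hB).mul h_exp.isHInf
  simp only [← sq] at h_mul
  exact h_mul

lemma norm_symbol (hc : Summable fun n => |c n|) (hz : ‖z‖ = 1) (hz_ne : z ≠ 1) :
    ‖symbol w c z‖ = Real.exp (-‖powerSum c id z‖ ^ 2) := by
  rw [symbol, norm_mul, norm_pow, norm_blaschke_eq_one hw_nonneg hw_lt_one hw_sum hz hz_ne,
    one_pow, one_mul, Complex.norm_exp, Complex.neg_re, re_normSqSeries id hc hz]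

open scoped ComplexOrder in
lemma symbol_nonneg (hz : ‖z‖ ≤ 1) (hz_ne : z ≠ 1) (hz_conj : conj z = z) :
    0 ≤ symbol w c z := by
  refine mul_nonneg (sq_nonneg_of_conj_eq ?_) (exp_nonneg_of_conj_eq ?_)
  · rw [← blaschke_conj hw_nonneg hw_lt_one hw_sum hz hz_ne, hz_conj]
  · rw [map_neg, normSqSeries, conj_powerSum, hz_conj]

end Symbol

section Growth

/-- The sum `∑ⱼ 8⁻²ʲ k_{wⱼ}` of Szegő kernels at the Blaschke zeros `wⱼ = 1 - 8⁻ʲ`. -/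
def kernelSum : H2 := ∑' j, (((8⁻¹ ^ j) ^ 2 : ℝ) : ℂ) • szego (lacunaryZero j)

lemma hasSum_kernelSum :
    HasSum (fun j => (((8⁻¹ ^ j) ^ 2 : ℝ) : ℂ) • szego (lacunaryZero j)) kernelSum := by
  refine (Summable.of_norm_bounded summable_inv_eight_pow fun j => ?_).hasSum
  have h_kernel := norm_szego_le (norm_lacunaryZero_lt_one j)
  rw [Complex.norm_real, Real.norm_of_nonneg (lacunaryZero_nonneg j), one_sub_lacunaryZero]
    at h_kernel
  calc ‖(((8⁻¹ ^ j) ^ 2 : ℝ) : ℂ) • szego (lacunaryZero j)‖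
      ≤ (8⁻¹ ^ j) ^ 2 * (8⁻¹ ^ j)⁻¹ := by
        rw [norm_smul, Complex.norm_real, Real.norm_of_nonneg (by positivity)]
        gcongr
    _ = 8⁻¹ ^ j := by field_simp

variable {c : ℕ → ℝ} {ε δ r : ℝ}

lemma exists_mul_norm_blaschke_sq_le_norm_symbol (w : ℕ → ℝ) (hc : Summable fun n => |c n|) :
    ∃ κ > 0, ∀ z, ‖z‖ ≤ 1 → κ * ‖blaschke w z‖ ^ 2 ≤ ‖symbol w c z‖ := by
  obtain ⟨Q, hQ⟩ := (inDiscAlgebra_powerSum (fun p : ℕ × ℕ => Nat.dist (id p.1) (id p.2))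
    (summable_abs_mul_abs hc)).exists_bound
  refine ⟨Real.exp (-Q), Real.exp_pos _, fun z hz => ?_⟩
  rw [symbol, norm_mul, norm_pow, Complex.norm_exp, Complex.neg_re, mul_comm]
  gcongr
  exact (Complex.re_le_norm _).trans (hQ z hz)

lemma exp_div_le_norm_exp_simplePole (hε : 0 ≤ ε) {x η : ℝ} (h_pos : 0 < 1 + δ - x)
    (h_le : 1 + δ - x ≤ η) : Real.exp (ε / η) ≤ ‖Complex.exp (simplePole ε δ x)‖ := by
  have h_real : simplePole ε δ x = (ε / (1 + δ - x) : ℝ) := by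
    rw [simplePole, div_eq_mul_inv]
    push_cast
    rfl
  rw [h_real, Complex.norm_exp, Complex.ofReal_re]
  gcongr

lemma isHInf_symbol_lacunaryZero (hc : Summable fun n => |c n|) :
    IsHInf (symbol lacunaryZero c) :=
  isHInf_symbol lacunaryZero_nonneg lacunaryZero_lt_one summable_one_sub_lacunaryZero hc

lemma norm_symbol_lacunaryZero (hc : Summable fun n => |c n|) :
    ∀ᵐ t ∂σ, ‖symbol lacunaryZero c (circlePoint t)‖ =
      Real.exp (-‖powerSum c id (circlePoint t)‖ ^ 2) := by
  filter_upwards [ae_circlePoint_ne 1] with t ht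
  exact norm_symbol lacunaryZero_nonneg lacunaryZero_lt_one summable_one_sub_lacunaryZero hc
    (norm_circlePoint t) ht

open scoped ComplexOrder in
lemma mul_norm_le_hbNorm_dilate_kernelSum (hc : Summable fun n => |c n|)
    (hc_norm : ‖(isHInf_symbol_lacunaryZero hc).boundary ∞‖ ≤ 1) (hδ : 0 < δ)
    (h_le : ∀ z, ‖z‖ ≤ 1 → ‖powerSum c id z * Complex.exp (simplePole ε δ z)‖ ≤ 2⁻¹)
    (hr : |r| < 1)
    (h_mem : dilate kernelSum r ∈ space ((isHInf_symbol_lacunaryZero hc).boundary ∞)) (j : ℕ) :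
    (8⁻¹ ^ j) ^ 2 * ‖symbol lacunaryZero c (r * lacunaryZero j) *
        Complex.exp (simplePole ε δ (r * lacunaryZero j))‖ ≤
      hbNorm ((isHInf_symbol_lacunaryZero hc).boundary ∞) (dilate kernelSum r) := by
  have h_nonneg (i : ℕ) : 0 ≤ symbol lacunaryZero c (r * lacunaryZero i) *
      Complex.exp (simplePole ε δ (r * lacunaryZero i)) := by
    have h_norm := norm_ofReal_mul_lt_one hr (norm_lacunaryZero_lt_one i).le
    have h_conj : conj ((r : ℂ) * lacunaryZero i) = r * lacunaryZero i := by
      rw [map_mul, Complex.conj_ofReal, Complex.conj_ofReal]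
    have h_ne : (r : ℂ) * lacunaryZero i ≠ 1 := fun h => by
      rw [h, norm_one] at h_norm
      exact lt_irrefl _ h_norm
    refine mul_nonneg (symbol_nonneg lacunaryZero_nonneg lacunaryZero_lt_one
      summable_one_sub_lacunaryZero h_norm.le h_ne h_conj) (exp_nonneg_of_conj_eq ?_)
    rw [← simplePole_conj, h_conj]
  have h_coeff_nonneg (i : ℕ) : (0 : ℝ) ≤ (8⁻¹ ^ i) ^ 2 := by positivity
  have h_weight := one_sub_norm_sq_mul_norm_sq_le_one (norm_symbol_lacunaryZero hc) h_le
  have h_bound := mul_norm_le_hbNorm_dilate (isHInf_symbol_lacunaryZero hc) hc_norm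
    (inDiscAlgebra_exp_simplePole (ε := ε) hδ).isHInf h_weight h_coeff_nonneg
    norm_lacunaryZero_lt_one hasSum_kernelSum hr h_mem
  exact h_bound h_nonneg j

lemma exists_mul_exp_le_hbNorm_dilate_kernelSum (hc : Summable fun n => |c n|)
    (hc_norm : ‖(isHInf_symbol_lacunaryZero hc).boundary ∞‖ ≤ 1)
    (h_mem : ∀ r : ℝ, |r| < 1 →
      dilate kernelSum r ∈ space ((isHInf_symbol_lacunaryZero hc).boundary ∞)) :
    ∃ κ > 0, ∀ r, 7 / 8 ≤ r → r < 1 → ∀ ε δ : ℝ, 0 ≤ ε → 0 < δ → δ ≤ 1 - r →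
      (∀ z, ‖z‖ ≤ 1 → ‖powerSum c id z * Complex.exp (simplePole ε δ z)‖ ≤ 2⁻¹) →
      κ * (1 - r) ^ 2 * Real.exp (ε / (3 * (1 - r))) ≤
        hbNorm ((isHInf_symbol_lacunaryZero hc).boundary ∞) (dilate kernelSum r) := by
  obtain ⟨κ, hκ, h_blaschke⟩ := exists_le_norm_blaschke_lacunaryZero
  obtain ⟨κ', hκ', h_symbol⟩ := exists_mul_norm_blaschke_sq_le_norm_symbol lacunaryZero hc
  refine ⟨κ' * κ ^ 2 / 64 ^ 2, by positivity, fun r hr hr_lt ε δ hε hδ hδ_le h_le => ?_⟩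
  have hr_abs : |r| < 1 := abs_lt.mpr ⟨by linarith, hr_lt⟩
  obtain ⟨j, hj_ge, hj_le, hj⟩ := h_blaschke (1 - r) (by linarith) (by linarith)
  rw [sub_sub_cancel, Complex.ofReal_mul] at hj
  have h_dist : 1 - r * lacunaryZero j ≤ 2 * (1 - r) := by
    rw [← one_sub_lacunaryZero] at hj_le
    nlinarith [lacunaryZero_nonneg j, lacunaryZero_lt_one j]
  have h_dist_pos : 0 < 1 - r * lacunaryZero j := by
    nlinarith [lacunaryZero_nonneg j, lacunaryZero_lt_one j]
  have h_exp := exp_div_le_norm_exp_simplePole (δ := δ) (x := r * lacunaryZero j)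
    (η := 3 * (1 - r)) hε (by linarith) (by linarith)
  rw [Complex.ofReal_mul] at h_exp
  refine le_trans ?_ (mul_norm_le_hbNorm_dilate_kernelSum hc hc_norm hδ h_le hr_abs
    (h_mem r hr_abs) j)
  calc κ' * κ ^ 2 / 64 ^ 2 * (1 - r) ^ 2 * Real.exp (ε / (3 * (1 - r)))
      = ((1 - r) / 64) ^ 2 * (κ' * κ ^ 2 * Real.exp (ε / (3 * (1 - r)))) := by ring
    _ ≤ (8⁻¹ ^ j) ^ 2 * (κ' * ‖blaschke lacunaryZero (r * lacunaryZero j)‖ ^ 2 *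
          ‖Complex.exp (simplePole ε δ (r * lacunaryZero j))‖) := by gcongr
    _ ≤ _ := by
        rw [norm_mul]
        gcongr
        exact h_symbol _ (norm_ofReal_mul_lt_one hr_abs (norm_lacunaryZero_lt_one j).le).le

lemma eventually_le_hbNorm_dilate_kernelSum (hc : Summable fun n => |c n|)
    (hc_norm : ‖(isHInf_symbol_lacunaryZero hc).boundary ∞‖ ≤ 1)
    (h_mem : ∀ r : ℝ, |r| < 1 →
      dilate kernelSum r ∈ space ((isHInf_symbol_lacunaryZero hc).boundary ∞))
    {ε δ : ℕ → ℝ} (hε : ∀ n, 0 ≤ ε n) (hδ : ∀ n, 0 < δ n)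
    (h_le : ∀ n z, ‖z‖ ≤ 1 → ‖powerSum c id z * Complex.exp (simplePole (ε n) (δ n) z)‖ ≤ 2⁻¹)
    {γ : ℝ → ℝ} (hγ : ∀ᶠ r in 𝓝[<] 1, ∃ n, δ n ≤ 1 - r ∧
      γ r ≤ (1 - r) ^ 3 * Real.exp (ε n / 3 / (1 - r))) :
    ∀ᶠ r in 𝓝[<] 1,
      γ r ≤ hbNorm ((isHInf_symbol_lacunaryZero hc).boundary ∞) (dilate kernelSum r) := by
  obtain ⟨κ, hκ, h_growth⟩ := exists_mul_exp_le_hbNorm_dilate_kernelSum hc hc_norm h_mem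
  filter_upwards [hγ, Ioo_mem_nhdsLT (show (7 / 8 : ℝ) < 1 by norm_num),
    Ioo_mem_nhdsLT (sub_lt_self 1 hκ)] with r ⟨n, hδ_le, hγ_le⟩ hr hr_κ
  calc γ r ≤ (1 - r) * (1 - r) ^ 2 * Real.exp (ε n / (3 * (1 - r))) := by
        rwa [← pow_succ', ← div_div]
    _ ≤ κ * (1 - r) ^ 2 * Real.exp (ε n / (3 * (1 - r))) := by
        gcongr
        linarith [hr_κ.1]
    _ ≤ _ := h_growth r hr.1.le hr.2 (ε n) (δ n) (hε n) (hδ n) hδ_le (h_le n)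

lemma kernelSum_mem_space (hc : Summable fun n => |c n|)
    (hc_norm : ‖(isHInf_symbol_lacunaryZero hc).boundary ∞‖ ≤ 1) :
    kernelSum ∈ space ((isHInf_symbol_lacunaryZero hc).boundary ∞) :=
  mem_space_of_toeplitz_star_eq_zero hc_norm (toeplitz_star_eq_zero_of_hasSum_szego _
    norm_lacunaryZero_lt_one symbol_apply_zero hasSum_kernelSum)

end Growth

end DBR

end

open DBR in
theorem mainTheorem4 (γ : ℝ → ℝ) (hγ : ∀ r ∈ Ioo (0 : ℝ) 1, 1 < γ r)
    (hγo : (fun r => Real.log (γ r)) =o[𝓝[<] (1 : ℝ)] fun r => (1 - r)⁻¹) :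
    ∃ b : DBR.HInf, DBR.NonExtreme b ∧ ∃ f ∈ DBR.space b,
      ∃ r₀ ∈ Ioo (0 : ℝ) 1, ∀ r ∈ Ioo r₀ 1,
        DBR.dilate f r ∈ DBR.space b ∧ γ r ≤ DBR.hbNorm b (DBR.dilate f r) := by
  obtain ⟨δ, hδ, hγ_le⟩ := exists_eventually_exists_le_one_sub_pow_mul_exp hγo 3
    (ε := fun n => 2⁻¹ ^ n / 3) fun n => by positivity
  obtain ⟨c, hc, hA_ne, hA_le, hA_exp⟩ := exists_powerSum_ne_zero_norm_mul_exp_le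
    (ε := fun n => 2⁻¹ ^ n) (fun n => by positivity)
    (summable_geometric_of_lt_one (by norm_num) (by norm_num)) hδ
  have hA := inDiscAlgebra_powerSum id hc
  have hF := isHInf_symbol_lacunaryZero hc
  have hFA := norm_symbol_lacunaryZero hc
  have hb := nonExtreme_boundary hF hFA hA (hA_ne 0 (by simp)) hA_le
  have hb_norm := mem_closedBall_zero_iff.mp hb.1
  have h_mem (r : ℝ) (hr : |r| < 1) : dilate kernelSum r ∈ space (hF.boundary ∞) :=
    dilate_mem_space hb_norm hA hA_ne (norm_sq_add_norm_boundary_sq_le_one hF hFA hA_le) _ hr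
  have h_eventually := eventually_le_hbNorm_dilate_kernelSum hc hb_norm h_mem
    (fun n => by positivity) hδ hA_exp hγ_le
  obtain ⟨r₀, hr₀, h_le⟩ :=
    (mem_nhdsLT_iff_exists_mem_Ico_Ioo_subset (by norm_num : (2⁻¹ : ℝ) < 1)).mp h_eventually
  have hr₀_pos : 0 < r₀ := lt_of_lt_of_le (by norm_num) hr₀.1
  exact ⟨_, hb, kernelSum, kernelSum_mem_space hc hb_norm, r₀, ⟨hr₀_pos, hr₀.2⟩,
    fun r hr => ⟨h_mem r (abs_lt.mpr ⟨by linarith [hr.1], hr.2⟩), h_le hr⟩⟩
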